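/- Fix an integer $D\ge 3$. For $J=(J_S)$ indexed by the $D$-element subsets $S\subset[n]$, let $H[J]=\sum_{S}J_S\prod_{k\in S}Z_k$ on $n$ qubits, and let $|\Psi(J,\beta,\gamma)\rangle=e^{-i\frac{\beta}{2}\sum_kX_k}\,e^{-i\frac{\gamma}{2}H[J]}\,|+\rangle^{\otimes n}$ be the level-1 QAOA state, where $\beta,\gamma\in\mathbf R$. Write $J\sim\mathrm{Dense}(D,n)$ if the $J_S$ are i.i.d. with law $n^{(1-D)/2}\mathcal N(0,1)$, and, for $d\geq 3$ (real), $J\sim\mathrm{Diluted}(D,n,d)$ if the $J_S$ are i.i.d. Bernoulli with parameter $\frac{nd}{D\binom nD}$ (which lies in $[0,1]$ for $n$ large). Put $$F_D(\beta,\gamma)=-\frac{i\gamma}{2}\left[\left(\cos\beta+i\sin\beta\,e^{-\frac{\gamma^2}{2(D-1)!}}\right)^D-\left(\cos\beta-i\sin\beta\,e^{-\frac{\gamma^2}{2(D-1)!}}\right)^D\right].$$ Then the following expectations and limits exist, and $$\lim_{n\to\infty}\mathbf E_{J\sim\mathrm{Dense}(D,n)}\left\langle\Psi(J,\beta,\gamma)\left|\tfrac{H[J]}{n/D!}\right|\Psi(J,\beta,\gamma)\right\rangle=F_D(\beta,\gamma),$$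 $$\lim_{n\to\infty}\mathbf E_{J\sim\mathrm{Diluted}(D,n,d)}\left\langle\Psi\left(J,\beta,\tfrac{\gamma}{\sqrt{(D-1)!\,d}}\right)\left|\tfrac{H[J]}{nd/D}\right|\Psi\left(J,\beta,\tfrac{\gamma}{\sqrt{(D-1)!\,d}}\right)\right\rangle=\frac{F_D(\beta,\gamma)}{\sqrt{(D-1)!\,d}}+\mathcal O\!\left(\frac1d\right),$$ where for every $\Gamma$ the constant in $\mathcal O(1/d)$ can be chosen to depend on $D$ and $\Gamma$ only, uniformly in $d\ge3$, $\beta\in\mathbf R$ and $|\gamma|\le\Gamma$. In particular the diluted limit equals $\frac{1}{\sqrt{(D-1)!\,d}}$ times the dense limit, up to $\mathcal O(1/d)$. -/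

import Mathlib

open MeasureTheory ProbabilityTheory Filter Topology
open scoped Nat

namespace QAOA

noncomputable section

/-- The index set of the couplings: subsets `{k₁, …, k_D}` of `[n]` with `D` elements. -/
abbrev Hyperedge (D n : ℕ) : Type := {S : Finset (Fin n) // S.card = D}

/-- The classical Hamiltonian `H[J](σ) = ∑_S J_S ∏_{k ∈ S} σ_k`. -/
def hamiltonian {D n : ℕ} (J : Hyperedge D n → ℝ) (σ : Fin n → ℝ) : ℝ :=
  ∑ S : Hyperedge D n, J S * ∏ k ∈ S.1, σ k

/-- Labels of the computational basis of `n` qubits. -/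
abbrev Bits (n : ℕ) : Type := Fin n → Bool

/-- The spin configuration of a basis state: the eigenvalues of `Z_k` on it. -/
def spin {n : ℕ} (x : Bits n) : Fin n → ℝ := fun k => if x k then -1 else 1

/-- The problem Hamiltonian `∑_S J_S ∏_{k ∈ S} Z_k`, diagonal in the computational basis. -/
def problemHamiltonian {D n : ℕ} (J : Hyperedge D n → ℝ) : Matrix (Bits n) (Bits n) ℂ :=
  Matrix.diagonal fun x => (hamiltonian J (spin x) : ℂ)

/-- The Pauli matrix `X` acting on qubit `k`. -/
def pauliX {n : ℕ} (k : Fin n) : Matrix (Bits n) (Bits n) ℂ :=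
  Matrix.of fun x y => if y = Function.update x k (!x k) then 1 else 0

/-- The mixer Hamiltonian `∑_k X_k`. -/
def mixerHamiltonian (n : ℕ) : Matrix (Bits n) (Bits n) ℂ := ∑ k : Fin n, pauliX k

/-- The state `|+⟩^{⊗ n}`. -/
def plusState (n : ℕ) : Bits n → ℂ := fun _ => ((1 / Real.sqrt (2 ^ n) : ℝ) : ℂ)

/-- The level-1 variational state `e^{-i β/2 H_B} e^{-i γ/2 H[J]} |+⟩`. -/
def state {D n : ℕ} (J : Hyperedge D n → ℝ) (β γ : ℝ) : Bits n → ℂ :=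
  Matrix.mulVec (NormedSpace.exp ((-(Complex.I * (β / 2))) • mixerHamiltonian n))
    (Matrix.mulVec (NormedSpace.exp ((-(Complex.I * (γ / 2))) • problemHamiltonian J))
      (plusState n))

/-- The energy `⟨Ψ(J, β, γ)| H[J] |Ψ(J, β, γ)⟩`. -/
def energy {D n : ℕ} (J : Hyperedge D n → ℝ) (β γ : ℝ) : ℂ :=
  dotProduct (star (state J β γ)) (Matrix.mulVec (problemHamiltonian J) (state J β γ))

/-- `Dense(D, n)`: i.i.d. couplings distributed as `n^{(1 - D)/2} 𝒩(0, 1)`. -/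
def denseLaw (D n : ℕ) : Measure (Hyperedge D n → ℝ) :=
  Measure.pi fun _ =>
    (gaussianReal 0 1).map fun x => (n : ℝ) ^ ((1 - (D : ℝ)) / 2) * x

/-- The success probability `n d / (D (n choose D))`. It is truncated to `[0, 1]`, which for fixed
`D ≥ 3` and `d ≥ 0` has no effect once `n` is large. -/
def dilutedProb (D n : ℕ) (d : ℝ) : unitInterval :=
  Set.projIcc 0 1 zero_le_one ((n : ℝ) * d / ((D : ℝ) * (n.choose D : ℝ)))

/-- `Diluted(D, n, d)`: i.i.d. couplings, `1` with probability `n d / (D (n choose D))` and `0`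
otherwise. -/
def dilutedLaw (D n : ℕ) (d : ℝ) : Measure (Hyperedge D n → ℝ) :=
  Measure.pi fun _ => bernoulliMeasure (1 : ℝ) 0 (dilutedProb D n d)

/-- `-(iγ/2) [(cos β + i sin β e^{-γ²/(2(D-1)!)})^D - (cos β - i sin β e^{-γ²/(2(D-1)!)})^D]`. -/
def closedForm (D : ℕ) (β γ : ℝ) : ℂ :=
  -(Complex.I * γ / 2) *
    ((Real.cos β + Complex.I * Real.sin β * Real.exp (-(γ ^ 2) / (2 * (D - 1)!))) ^ D
      - (Real.cos β - Complex.I * Real.sin β * Real.exp (-(γ ^ 2) / (2 * (D - 1)!))) ^ D)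

end

end QAOA

namespace QAOA

noncomputable section

/-! Work in the Heisenberg picture. Each qubit outside `S` contributes the identity when `∏_{k ∈ S}
Z_k` is conjugated by the mixer, and each qubit in `S` contributes `cos β Z + sin β Y`. Expanding
over the set `T ⊆ S` of sites carrying `Y` (those whose bit is flipped) makes the energy a sum over
`S` and `T` of the weight `(cos β)^(D-t) (-i sin β)^t`, `t = |T|`, times the average over uniform
bit strings `y` of `χ_S(y) J_S exp(iγ ∑ J_{S'} χ_{S'}(y))`. Here `χ` is the spin product, and only
hyperedges `S'` with `|S' ∩ T|` odd occur in the phase (`energy_eq`).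

For i.i.d. couplings with law `μ` the expectation factorises into a first-moment transform at `S`
and characteristic functions at the other hyperedges (`integral_energy`). Writing `charFun μ γ = exp
l`, the product of the latter has modulus `exp(N Re l)`, where `N` counts the odd neighbours, and
phase `Im l · ∑ χ_{S'}(y)`. By orthogonality of characters that sum has typical size `√N`, so the
phase disappears when `n^(D-1) (Im l)² → 0`; what remains averages to `i` times the imaginary part
of the moment (`norm_flipMean_sub_le`).

Double counting gives `N ≈ t n^(D-1) / (D-1)!`, so the limit depends on `T` only through `t`, and
vanishes for even `t` (`tendsto_integral_energy`). The binomial theorem then yields the difference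
of two `D`-th powers (`limitEnergy_eq`). Gaussian couplings give `closedForm`. Bernoulli couplings
give the same expression with `sin γ` as prefactor and damping `exp(d (cos γ - 1))`; at angle `γ /
√((D-1)! d)`, Taylor bounds on sine and cosine compare the two up to `O(1/d)`
(`norm_dilutedLimit_sub_le`). -/

/-! ### Diagonalisation and matrix entries of the mixer. -/

/-- A sum over bit strings of a product over the bits is a product of one-bit sums. -/
theorem sum_prod_bits {R : Type*} [CommSemiring R] {n : ℕ} (f : Fin n → Bool → R) :
    ∑ x : Bits n, ∏ k, f k (x k) = ∏ k, (f k true + f k false) := by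
  have h := Finset.prod_univ_sum (fun _ : Fin n => (Finset.univ : Finset Bool)) f
  simp only [Fintype.piFinset_univ] at h
  rw [← h]
  simp

/-- The unnormalised Hadamard transform of `n` qubits. -/
def hadamard (n : ℕ) : Matrix (Bits n) (Bits n) ℂ :=
  Matrix.of fun x y => ∏ k, if x k && y k then -1 else 1

theorem hadamard_mul_self (n : ℕ) :
    hadamard n * hadamard n = (2 ^ n : ℂ) • (1 : Matrix (Bits n) (Bits n) ℂ) := by
  ext x y
  simp only [Matrix.mul_apply, hadamard, Matrix.of_apply, ← Finset.prod_mul_distrib]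
  rw [sum_prod_bits (fun k b => (if x k && b then (-1 : ℂ) else 1) * if b && y k then -1 else 1)]
  by_cases h : x = y
  · subst h
    have : ∀ k : Fin n, (((if x k && true then (-1 : ℂ) else 1) * if true && x k then -1 else 1)
        + (if x k && false then (-1 : ℂ) else 1) * if false && x k then -1 else 1) = 2 := by
      intro k; cases x k <;> norm_num
    simp only [this]
    simp
  · obtain ⟨k, hk⟩ := Function.ne_iff.1 h
    rw [Finset.prod_eq_zero (Finset.mem_univ k)]
    · simp [h]
    · revert hk; cases x k <;> cases y k <;> simp

/-- The columns of the Hadamard transform are eigenvectors of `X_k`: flipping bit `k` of the row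
index changes the entry by the sign `spin y k`. -/
theorem pauliX_mul_hadamard {n : ℕ} (k : Fin n) :
    pauliX k * hadamard n = hadamard n * Matrix.diagonal fun y => (spin y k : ℂ) := by
  ext x y
  rw [Matrix.mul_diagonal, Matrix.mul_apply]
  simp only [pauliX, Matrix.of_apply, ite_mul, one_mul, zero_mul, Finset.sum_ite_eq',
    Finset.mem_univ, if_true]
  have h : (spin y k : ℂ) = ∏ j, if j = k then (spin y k : ℂ) else 1 := by simp
  rw [h]
  simp only [hadamard, Matrix.of_apply, ← Finset.prod_mul_distrib]
  refine Finset.prod_congr rfl fun j _ => ?_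
  by_cases hj : j = k
  · subst hj
    cases x j <;> cases hy : y j <;> simp [spin, hy]
  · simp [hj]

theorem mixerHamiltonian_mul_hadamard (n : ℕ) :
    mixerHamiltonian n * hadamard n
      = hadamard n * Matrix.diagonal fun y => ∑ k, (spin y k : ℂ) := by
  rw [mixerHamiltonian, Finset.sum_mul]
  simp only [pauliX_mul_hadamard, ← Finset.mul_sum]
  congr 1
  ext x y
  rw [Matrix.sum_apply]
  by_cases h : x = y
  · subst h; simp
  · simp [h]

/-- The Hadamard transform diagonalises all `X_k` at once, and it is its own inverse up to the
factor `2 ^ n`; the exponential is thus taken on the diagonal. -/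
theorem mixer_exp_eq (n : ℕ) (c : ℂ) :
    NormedSpace.exp (c • mixerHamiltonian n) = (2 ^ n : ℂ)⁻¹ •
      (hadamard n * Matrix.diagonal (fun y => ∏ k, Complex.exp (c * spin y k)) * hadamard n) := by
  have h2 : (2 ^ n : ℂ) ≠ 0 := pow_ne_zero _ two_ne_zero
  have hl : hadamard n * ((2 ^ n : ℂ)⁻¹ • hadamard n) = 1 := by
    rw [Matrix.mul_smul, hadamard_mul_self, smul_smul, inv_mul_cancel₀ h2, one_smul]
  have hinv : (hadamard n)⁻¹ = (2 ^ n : ℂ)⁻¹ • hadamard n := Matrix.inv_eq_right_inv hl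
  have hu : IsUnit (hadamard n) := .of_mul_eq_one _ hl
  have hm : c • mixerHamiltonian n
      = hadamard n * Matrix.diagonal (fun y => c * ∑ k, (spin y k : ℂ)) * (hadamard n)⁻¹ := by
    have : Matrix.diagonal (fun y : Bits n => c * ∑ k, (spin y k : ℂ))
        = c • Matrix.diagonal (fun y : Bits n => ∑ k, (spin y k : ℂ)) := by
      ext x y; by_cases h : x = y <;> simp [h, Matrix.diagonal]
    rw [this, Matrix.mul_smul, ← mixerHamiltonian_mul_hadamard, Matrix.smul_mul, Matrix.mul_assoc,
      hinv, hl, Matrix.mul_one]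
  rw [hm, Matrix.exp_conj _ _ hu, Matrix.exp_diagonal, hinv, Matrix.mul_smul]
  congr 4
  ext y
  rw [Pi.coe_exp, ← Complex.exp_eq_exp_ℂ, Finset.mul_sum, Complex.exp_sum]

/-- The matrix entries of the one-qubit rotation `e^{-i β/2 X}`. -/
def rotX (β : ℝ) (a b : Bool) : ℂ :=
  if a = b then (Real.cos (β / 2) : ℂ) else -Complex.I * Real.sin (β / 2)

theorem mixer_exp_apply {n : ℕ} (β : ℝ) (x y : Bits n) :
    NormedSpace.exp ((-(Complex.I * (β / 2))) • mixerHamiltonian n) x y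
      = ∏ k, rotX β (x k) (y k) := by
  rw [mixer_exp_eq, Matrix.smul_apply, Matrix.mul_apply]
  simp only [Matrix.mul_diagonal, hadamard, Matrix.of_apply, ← Finset.prod_mul_distrib, spin]
  rw [sum_prod_bits (fun k b => (if x k && b then (-1 : ℂ) else 1)
    * Complex.exp (-(Complex.I * (β / 2)) * ((if b then -1 else 1 : ℝ) : ℂ))
    * if b && y k then -1 else 1)]
  have h2 : (2 ^ n : ℂ)⁻¹ = ∏ _k : Fin n, (2 : ℂ)⁻¹ := by simp
  rw [h2, smul_eq_mul, ← Finset.prod_mul_distrib]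
  refine Finset.prod_congr rfl fun k _ => ?_
  have e1 : Complex.exp (-(Complex.I * (β / 2)) * ((-1 : ℝ) : ℂ))
      = Complex.cos (β / 2) + Complex.sin (β / 2) * Complex.I := by
    rw [← Complex.exp_mul_I]; congr 1; push_cast; ring
  have e2 : Complex.exp (-(Complex.I * (β / 2)) * ((1 : ℝ) : ℂ))
      = Complex.cos (β / 2) - Complex.sin (β / 2) * Complex.I := by
    have := Complex.exp_mul_I (-(β / 2 : ℂ))
    rw [Complex.cos_neg, Complex.sin_neg] at this
    rw [sub_eq_add_neg, ← neg_mul (Complex.sin _), ← this]; congr 1; push_cast; ring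
  cases x k <;> cases y k <;> simp only [rotX, Bool.and_true, Bool.and_false,
    if_true, if_false, e1, e2, Bool.false_eq_true, reduceCtorEq] <;> push_cast <;> ring

/-! ### Heisenberg evolution of the spin products. -/

/-- The spin product over a set of sites. -/
def character {n : ℕ} (S : Finset (Fin n)) (y : Bits n) : ℝ := ∏ k ∈ S, spin y k

/-- Weight of the Pauli string with `Y` on `T` and `Z` on the rest in the Heisenberg evolution
of `∏ Z` over `D` sites. -/
def flipWeight (D : ℕ) (β : ℝ) (t : ℕ) : ℂ :=
  (Real.cos β : ℂ) ^ (D - t) * (-Complex.I * Real.sin β) ^ t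

theorem state_apply {D n : ℕ} (J : Hyperedge D n → ℝ) (β γ : ℝ) (x : Bits n) :
    state J β γ x = ∑ y, (∏ k, rotX β (x k) (y k)) *
      (Complex.exp (-(Complex.I * (γ / 2)) * hamiltonian J (spin y)) *
        ((1 / Real.sqrt (2 ^ n) : ℝ) : ℂ)) := by
  have hd : (-(Complex.I * (γ / 2))) • problemHamiltonian J = Matrix.diagonal
      fun y : Bits n => -(Complex.I * (γ / 2)) * (hamiltonian J (spin y) : ℂ) := by
    ext x y; by_cases h : x = y <;> simp [h, problemHamiltonian, Matrix.diagonal]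
  rw [state, hd, Matrix.exp_diagonal, Matrix.mulVec, dotProduct]
  refine Finset.sum_congr rfl fun y _ => ?_
  rw [mixer_exp_apply, Matrix.mulVec_diagonal, Pi.coe_exp, ← Complex.exp_eq_exp_ℂ, plusState]

/-- Unitarity of the one-qubit rotation: the factor of a qubit outside `S`. -/
theorem star_rotX_sandwich (β : ℝ) (a b : Bool) :
    star (rotX β true a) * rotX β true b + star (rotX β false a) * rotX β false b
      = if a = b then 1 else 0 := by
  have h : (Real.sin (β / 2) : ℂ) ^ 2 + (Real.cos (β / 2) : ℂ) ^ 2 = 1 := by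
    exact_mod_cast Real.sin_sq_add_cos_sq (β / 2)
  cases a <;> cases b <;> simp [rotX, -Complex.ofReal_cos, -Complex.ofReal_sin] <;>
    first
      | linear_combination h - (Real.sin (β / 2) : ℂ) ^ 2 * Complex.I_sq
      | ring

/-- The matrix entries of `e^{iβX/2} Z e^{-iβX/2} = cos β Z + sin β Y`, by the double-angle
formulas: the factor of a qubit in `S`. -/
theorem star_rotX_sandwich_spin (β : ℝ) (a b : Bool) :
    -(star (rotX β true a) * rotX β true b) + star (rotX β false a) * rotX β false b
      = (if a then -1 else 1) * if a = b then (Real.cos β : ℂ) else -Complex.I * Real.sin β := by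
  have h1 : (Real.cos β : ℂ) = (Real.cos (β / 2) : ℂ) ^ 2 - (Real.sin (β / 2) : ℂ) ^ 2 := by
    rw [← Complex.ofReal_pow, ← Complex.ofReal_pow, ← Complex.ofReal_sub, ← Real.cos_two_mul']
    congr 2; ring
  have h2 : (Real.sin β : ℂ) = 2 * (Real.sin (β / 2) : ℂ) * (Real.cos (β / 2) : ℂ) := by
    rw [show β = 2 * (β / 2) by ring, Real.sin_two_mul]
    push_cast; ring_nf
  rw [h1, h2]
  cases a <;> cases b <;> simp [rotX, -Complex.ofReal_cos, -Complex.ofReal_sin] <;>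
    first
      | linear_combination (Real.sin (β / 2) : ℂ) ^ 2 * Complex.I_sq
      | linear_combination -(Real.sin (β / 2) : ℂ) ^ 2 * Complex.I_sq
      | ring

/-- Flip the bits in `T`. -/
def flipBits {n : ℕ} (y : Bits n) (T : Finset (Fin n)) : Bits n :=
  fun k => if k ∈ T then !y k else y k

/-- Bit strings are parametrised by the set of bits that differ from a fixed one. -/
def flipEquiv {n : ℕ} (y : Bits n) : Finset (Fin n) ≃ Bits n where
  toFun := flipBits y
  invFun z := Finset.univ.filter fun k => z k ≠ y k
  left_inv T := by ext k; simp [flipBits]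
  right_inv z := by
    ext k
    simp only [flipBits, Finset.mem_filter, Finset.mem_univ, true_and]
    cases z k <;> cases y k <;> simp

/-- The sum over `x` factorises over qubits. A flipped qubit outside `S` contributes an off-diagonal
entry of the identity, which forces `T ⊆ S`. -/
theorem prod_pauli_sandwich {n : ℕ} (β : ℝ) (S T : Finset (Fin n)) (y : Bits n) :
    ∑ x : Bits n, (character S x : ℂ) * (star (∏ k, rotX β (x k) (y k))
        * ∏ k, rotX β (x k) (flipBits y T k))
      = if T ⊆ S then flipWeight S.card β T.card * character S y else 0 := by
  have hch : ∀ x : Bits n, (character S x : ℂ)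
      = ∏ k, if k ∈ S then (if x k then (-1 : ℂ) else 1) else 1 := by
    intro x
    rw [Finset.prod_ite_mem, Finset.univ_inter, character, Complex.ofReal_prod]
    refine Finset.prod_congr rfl fun k _ => ?_
    simp only [spin]; split_ifs <;> simp
  have hst : ∀ x : Bits n, star (∏ k, rotX β (x k) (y k)) = ∏ k, star (rotX β (x k) (y k)) :=
    fun x => map_prod (starRingEnd ℂ) _ _
  simp only [hch, hst, ← Finset.prod_mul_distrib]
  rw [sum_prod_bits (fun k b => (if k ∈ S then (if b then (-1 : ℂ) else 1) else 1) *
    (star (rotX β b (y k)) * rotX β b (flipBits y T k)))]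
  have key : ∀ k, (if k ∈ S then (if true then (-1 : ℂ) else 1) else 1) *
        (star (rotX β true (y k)) * rotX β true (flipBits y T k))
      + (if k ∈ S then (if false then (-1 : ℂ) else 1) else 1) *
        (star (rotX β false (y k)) * rotX β false (flipBits y T k))
      = (if k ∈ S then (if y k then (-1 : ℂ) else 1) else 1) *
        (if k ∈ S then (if k ∈ T then -Complex.I * Real.sin β else (Real.cos β : ℂ))
          else if k ∈ T then 0 else 1) := by
    intro k
    have h1 := star_rotX_sandwich β (y k) (flipBits y T k)
    have h2 := star_rotX_sandwich_spin β (y k) (flipBits y T k)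
    have h3 : (y k = flipBits y T k) ↔ k ∉ T := by
      simp only [flipBits]; split_ifs with h <;> simp [h]
    simp only [h3] at h1 h2
    by_cases hS : k ∈ S <;> by_cases hT : k ∈ T <;> simp_all
  rw [Finset.prod_congr rfl fun k _ => key k, Finset.prod_mul_distrib]
  split_ifs with hTS
  · rw [mul_comm]
    congr 1
    have h : ∀ k ∈ (Finset.univ : Finset (Fin n)), (if k ∈ S then
        (if k ∈ T then -Complex.I * Real.sin β else (Real.cos β : ℂ)) else if k ∈ T then 0 else 1)
        = if k ∈ S then (if k ∈ T then -Complex.I * Real.sin β else (Real.cos β : ℂ)) else 1 := by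
      intro k _
      by_cases hS : k ∈ S
      · simp [hS]
      · have hT : k ∉ T := fun h => hS (hTS h)
        simp [hS, hT]
    rw [Finset.prod_congr rfl h, Finset.prod_ite_mem, Finset.univ_inter, Finset.prod_ite,
      Finset.prod_const, Finset.prod_const, Finset.filter_mem_eq_inter,
      Finset.inter_eq_right.2 hTS, Finset.filter_notMem_eq_sdiff, Finset.card_sdiff_of_subset hTS,
      flipWeight, mul_comm]
  · obtain ⟨k, hkT, hkS⟩ := Finset.not_subset.1 hTS
    rw [mul_eq_zero]; right
    exact Finset.prod_eq_zero (Finset.mem_univ k) (by simp [hkT, hkS])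

theorem character_flipBits {n : ℕ} (S T : Finset (Fin n)) (y : Bits n) :
    character S (flipBits y T) = (-1) ^ (S ∩ T).card * character S y := by
  rw [← Finset.prod_const, ← Finset.filter_mem_eq_inter, Finset.prod_filter, character, character,
    ← Finset.prod_mul_distrib]
  refine Finset.prod_congr rfl fun k _ => ?_
  by_cases h : k ∈ T <;> cases hy : y k <;> simp [spin, flipBits, h, hy]

/-- Only terms meeting `T` in an odd number of sites change sign. The factor 2 cancels the `1/2` in
the angle `γ/2`. -/
theorem hamiltonian_sub_flipBits {D n : ℕ} (J : Hyperedge D n → ℝ) (T : Finset (Fin n))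
    (y : Bits n) :
    hamiltonian J (spin y) - hamiltonian J (spin (flipBits y T))
      = 2 * ∑ S : Hyperedge D n, if Odd (S.1 ∩ T).card then J S * character S.1 y else 0 := by
  rw [hamiltonian, hamiltonian, ← Finset.sum_sub_distrib, Finset.mul_sum]
  refine Finset.sum_congr rfl fun S _ => ?_
  have h := character_flipBits S.1 T y
  rw [character] at h
  rw [h, character]
  split_ifs with ho
  · rw [ho.neg_one_pow]; ring
  · rw [(Nat.not_odd_iff_even.1 ho).neg_one_pow]; ring

theorem sum_pauli_sandwich {n : ℕ} (β : ℝ) (S : Finset (Fin n)) (amp : Bits n → ℂ) :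
    ∑ x : Bits n, (character S x : ℂ) * (star (∑ y, (∏ k, rotX β (x k) (y k)) * amp y)
        * ∑ z, (∏ k, rotX β (x k) (z k)) * amp z)
      = ∑ T ∈ S.powerset, flipWeight S.card β T.card *
          ∑ y, (character S y : ℂ) * (star (amp y) * amp (flipBits y T)) := by
  have e1 : ∀ x : Bits n, (character S x : ℂ) * (star (∑ y, (∏ k, rotX β (x k) (y k)) * amp y)
        * ∑ z, (∏ k, rotX β (x k) (z k)) * amp z)
      = ∑ y, ∑ T, (star (amp y) * amp (flipBits y T)) * ((character S x : ℂ) *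
        (star (∏ k, rotX β (x k) (y k)) * ∏ k, rotX β (x k) (flipBits y T k))) := by
    intro x
    rw [star_sum, Finset.sum_mul, Finset.mul_sum]
    refine Finset.sum_congr rfl fun y _ => ?_
    -- The second bit string of the double sum is written as `y` with a set `T` of bits flipped.
    rw [← (flipEquiv y).sum_comp, Finset.mul_sum, Finset.mul_sum]
    refine Finset.sum_congr rfl fun T _ => ?_
    rw [star_mul']
    simp only [flipEquiv, Equiv.coe_fn_mk]
    ring
  simp only [e1]
  rw [Finset.sum_comm]
  have e2 : ∀ y : Bits n, ∑ x : Bits n, ∑ T, (star (amp y) * amp (flipBits y T)) *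
      ((character S x : ℂ) *
        (star (∏ k, rotX β (x k) (y k)) * ∏ k, rotX β (x k) (flipBits y T k)))
      = ∑ T ∈ S.powerset, flipWeight S.card β T.card *
        ((character S y : ℂ) * (star (amp y) * amp (flipBits y T))) := by
    intro y
    rw [Finset.sum_comm]
    simp only [← Finset.mul_sum, prod_pauli_sandwich]
    simp only [mul_ite, mul_zero, ← Finset.mem_powerset]
    rw [Finset.sum_ite_mem, Finset.univ_inter]
    exact Finset.sum_congr rfl fun T _ => by ring
  simp only [e2]
  rw [Finset.sum_comm]
  simp only [Finset.mul_sum]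

/-- The energy of the level-1 state, after evolving `∏ Z` backwards through the mixer. -/
theorem energy_eq {D n : ℕ} (J : Hyperedge D n → ℝ) (β γ : ℝ) :
    energy J β γ = ∑ S : Hyperedge D n, ∑ T ∈ S.1.powerset, flipWeight D β T.card *
      ((2 ^ n : ℂ)⁻¹ * ∑ y : Bits n, (character S.1 y : ℂ) * (J S * Complex.exp (Complex.I * γ *
        ∑ S' : Hyperedge D n,
          if Odd (S'.1 ∩ T).card then (J S' : ℂ) * character S'.1 y else 0))) := by
  have h0 : energy J β γ = ∑ S : Hyperedge D n, (J S : ℂ) * ∑ x : Bits n, (character S.1 x : ℂ) *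
      (star (state J β γ x) * state J β γ x) := by
    simp only [energy, dotProduct, problemHamiltonian, Matrix.mulVec_diagonal, Pi.star_apply,
      hamiltonian, Complex.ofReal_sum, Complex.ofReal_mul, Finset.mul_sum, Finset.sum_mul]
    rw [Finset.sum_comm]
    refine Finset.sum_congr rfl fun S _ => Finset.sum_congr rfl fun x _ => ?_
    rw [character]; ring
  rw [h0]
  refine Finset.sum_congr rfl fun S _ => ?_
  simp only [state_apply]
  rw [sum_pauli_sandwich, Finset.mul_sum, S.2]
  refine Finset.sum_congr rfl fun T _ => ?_
  rw [← mul_assoc, mul_comm (J S : ℂ), mul_assoc]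
  congr 1
  rw [Finset.mul_sum, Finset.mul_sum]
  refine Finset.sum_congr rfl fun y _ => ?_
  have hs : (((1 / Real.sqrt (2 ^ n) : ℝ) : ℂ)) * ((1 / Real.sqrt (2 ^ n) : ℝ) : ℂ)
      = (2 ^ n : ℂ)⁻¹ := by
    rw [← Complex.ofReal_mul, div_mul_div_comm, Real.mul_self_sqrt (by positivity)]
    push_cast; rw [one_mul, one_div]
  have hc : star (Complex.exp (-(Complex.I * (γ / 2)) * hamiltonian J (spin y)))
      = Complex.exp (Complex.I * (γ / 2) * hamiltonian J (spin y)) := by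
    rw [show (γ / 2 : ℂ) = ((γ / 2 : ℝ) : ℂ) by push_cast; rfl, Complex.star_def,
      ← Complex.exp_conj]
    simp [-Complex.ofReal_div]
  have hH : Complex.exp (Complex.I * (γ / 2) * hamiltonian J (spin y))
        * Complex.exp (-(Complex.I * (γ / 2)) * hamiltonian J (spin (flipBits y T)))
      = Complex.exp (Complex.I * γ * ∑ S' : Hyperedge D n,
          if Odd (S'.1 ∩ T).card then (J S' : ℂ) * character S'.1 y else 0) := by
    rw [← Complex.exp_add]
    congr 1
    have := congrArg (fun r : ℝ => (r : ℂ)) (hamiltonian_sub_flipBits J T y)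
    simp only [Complex.ofReal_sub, Complex.ofReal_mul, Complex.ofReal_sum, Complex.ofReal_ofNat,
      apply_ite Complex.ofReal, Complex.ofReal_zero] at this
    linear_combination Complex.I * (γ / 2) * this
  rw [star_mul', hc, ← hH, ← hs]
  simp only [Complex.star_def, Complex.conj_ofReal]
  ring

/-! ### Expectation over i.i.d. couplings. -/

/-- The transform `t ↦ ∫ x e^{itx} dμ`, which is `-i` times the derivative of the characteristic
function. -/
def momentFun (μ : Measure ℝ) (t : ℝ) : ℂ := ∫ x, (x : ℂ) * Complex.exp (t * x * Complex.I) ∂μ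

theorem norm_exp_mul_mul_I (t x : ℝ) : ‖Complex.exp (t * x * Complex.I)‖ = 1 := by
  rw [← Complex.ofReal_mul, Complex.norm_exp_ofReal_mul_I]

theorem integrable_exp_mul_mul_I (μ : Measure ℝ) [IsProbabilityMeasure μ] (t : ℝ) :
    Integrable (fun x : ℝ => Complex.exp (t * x * Complex.I)) μ := by
  refine Integrable.of_bound (C := 1) (by fun_prop) (ae_of_all _ fun x => ?_)
  rw [norm_exp_mul_mul_I]

theorem integrable_mul_exp_mul_mul_I {μ : Measure ℝ} (hμ : Integrable (fun x : ℝ => x) μ) (t : ℝ) :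
    Integrable (fun x : ℝ => (x : ℂ) * Complex.exp (t * x * Complex.I)) μ := by
  refine hμ.mono (by fun_prop) (ae_of_all _ fun x => ?_)
  rw [norm_mul, norm_exp_mul_mul_I, mul_one, Complex.norm_real]

theorem momentFun_neg (μ : Measure ℝ) (t : ℝ) :
    momentFun μ (-t) = (starRingEnd ℂ) (momentFun μ t) := by
  rw [momentFun, momentFun, ← integral_conj]
  refine integral_congr_ae (ae_of_all _ fun x => ?_)
  simp [← Complex.exp_conj]

section Product

variable {ι : Type*} [DecidableEq ι] {μ : Measure ℝ} [IsProbabilityMeasure μ]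

/-- The one-coordinate factors of `x ↦ x s * exp (i ∑ τ k x k)`. -/
def factor (s : ι) (τ : ι → ℝ) (k : ι) (x : ℝ) : ℂ :=
  (if k = s then (x : ℂ) else 1) * Complex.exp (τ k * x * Complex.I)

theorem integrable_factor (hμ : Integrable (fun x : ℝ => x) μ) (s : ι) (τ : ι → ℝ) (k : ι) :
    Integrable (factor s τ k) μ := by
  by_cases h : k = s
  · have e : factor s τ k = fun x : ℝ => (x : ℂ) * Complex.exp (τ k * x * Complex.I) := by
      funext x; simp [factor, h]
    exact e ▸ integrable_mul_exp_mul_mul_I hμ (τ k)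
  · have e : factor s τ k = fun x : ℝ => Complex.exp (τ k * x * Complex.I) := by
      funext x; simp [factor, h]
    exact e ▸ integrable_exp_mul_mul_I μ (τ k)

variable [Fintype ι]

theorem prod_factor (s : ι) (τ x : ι → ℝ) :
    ∏ k, factor s τ k (x k) = (x s : ℂ) * Complex.exp (∑ k, τ k * x k * Complex.I) := by
  simp only [factor]
  rw [Finset.prod_mul_distrib, Complex.exp_sum, Finset.prod_ite_eq']
  simp

theorem integrable_coord_mul_exp (hμ : Integrable (fun x : ℝ => x) μ) (s : ι) (τ : ι → ℝ) :
    Integrable (fun x : ι → ℝ => (x s : ℂ) * Complex.exp (∑ k, τ k * x k * Complex.I))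
      (Measure.pi fun _ => μ) := by
  simp only [← prod_factor]
  exact Integrable.fintype_prod fun k => integrable_factor hμ s τ k

theorem integral_coord_mul_exp (s : ι) (τ : ι → ℝ) :
    ∫ x : ι → ℝ, (x s : ℂ) * Complex.exp (∑ k, τ k * x k * Complex.I) ∂(Measure.pi fun _ => μ)
      = momentFun μ (τ s) * ∏ k ∈ Finset.univ.erase s, charFun μ (τ k) := by
  simp only [← prod_factor]
  rw [integral_fintype_prod_eq_prod, ← Finset.mul_prod_erase _ _ (Finset.mem_univ s)]
  congr 1
  · simp [factor, momentFun]
  · refine Finset.prod_congr rfl fun k hk => ?_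
    rw [charFun_apply_real]
    simp [factor, Finset.ne_of_mem_erase hk]

end Product

/-- The coefficient of `J S'` in the phase attached to flipping the bits in `T`. -/
def phaseCoeff {D n : ℕ} (γ : ℝ) (T : Finset (Fin n)) (y : Bits n) (S' : Hyperedge D n) : ℝ :=
  if Odd (S'.1 ∩ T).card then γ * character S'.1 y else 0

theorem energy_eq_phaseCoeff {D n : ℕ} (J : Hyperedge D n → ℝ) (β γ : ℝ) :
    energy J β γ = ∑ S : Hyperedge D n, ∑ T ∈ S.1.powerset, flipWeight D β T.card *
      ((2 ^ n : ℂ)⁻¹ * ∑ y : Bits n, (character S.1 y : ℂ) * (J S * Complex.exp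
        (∑ S' : Hyperedge D n, (phaseCoeff γ T y S' : ℂ) * J S' * Complex.I))) := by
  rw [energy_eq]
  refine Finset.sum_congr rfl fun S _ => Finset.sum_congr rfl fun T _ => ?_
  congr 2
  refine Finset.sum_congr rfl fun y _ => ?_
  congr 3
  rw [Finset.mul_sum]
  refine Finset.sum_congr rfl fun S' _ => ?_
  simp only [phaseCoeff]
  split_ifs <;> push_cast <;> ring

theorem integrable_energy {D n : ℕ} (β γ : ℝ) {μ : Measure ℝ} [IsProbabilityMeasure μ]
    (hμ : Integrable (fun x : ℝ => x) μ) :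
    Integrable (fun J : Hyperedge D n → ℝ => energy J β γ) (Measure.pi fun _ => μ) := by
  simp only [energy_eq_phaseCoeff]
  refine integrable_finsetSum _ fun S _ => integrable_finsetSum _ fun T _ => ?_
  refine (Integrable.const_mul (integrable_finsetSum _ fun y _ => ?_) _).const_mul _
  exact (integrable_coord_mul_exp hμ S (phaseCoeff γ T y)).const_mul _

/-- The expectation of the energy contribution of `S` and of the flip set `T`. -/
def flipMean {D n : ℕ} (μ : Measure ℝ) (γ : ℝ) (S : Hyperedge D n) (T : Finset (Fin n)) : ℂ :=
  (2 ^ n : ℂ)⁻¹ * ∑ y : Bits n, (character S.1 y : ℂ) * (momentFun μ (phaseCoeff γ T y S) *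
    ∏ S' ∈ Finset.univ.erase S, charFun μ (phaseCoeff γ T y S'))

theorem integral_energy {D n : ℕ} (β γ : ℝ) {μ : Measure ℝ} [IsProbabilityMeasure μ]
    (hμ : Integrable (fun x : ℝ => x) μ) :
    ∫ J : Hyperedge D n → ℝ, energy J β γ ∂(Measure.pi fun _ => μ)
      = ∑ S : Hyperedge D n, ∑ T ∈ S.1.powerset, flipWeight D β T.card * flipMean μ γ S T := by
  have h (S : Hyperedge D n) (T : Finset (Fin n)) (y : Bits n) :=
    (integrable_coord_mul_exp hμ S (phaseCoeff γ T y)).const_mul (character S.1 y : ℂ)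
  have h' (S : Hyperedge D n) (T : Finset (Fin n)) :=
    (Integrable.const_mul (integrable_finsetSum Finset.univ fun y _ => h S T y)
      ((2 ^ n : ℂ)⁻¹)).const_mul (flipWeight D β T.card)
  simp only [energy_eq_phaseCoeff]
  rw [integral_finsetSum _ fun S _ => integrable_finsetSum _ fun T _ => h' S T]
  refine Finset.sum_congr rfl fun S _ => ?_
  rw [integral_finsetSum _ fun T _ => h' S T]
  refine Finset.sum_congr rfl fun T _ => ?_
  rw [integral_const_mul, integral_const_mul, integral_finsetSum _ fun y _ => h S T y]
  simp only [integral_const_mul, integral_coord_mul_exp, flipMean]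

/-! ### Orthogonality of the spin products. -/

theorem character_sq {n : ℕ} (S : Finset (Fin n)) (y : Bits n) : character S y ^ 2 = 1 := by
  rw [character, ← Finset.prod_pow]
  exact Finset.prod_eq_one fun k _ => by simp only [spin]; split_ifs <;> norm_num

theorem character_eq_or {n : ℕ} (S : Finset (Fin n)) (y : Bits n) :
    character S y = 1 ∨ character S y = -1 :=
  mul_self_eq_one_iff.1 (by rw [← pow_two, character_sq])

theorem sum_character_mul {n : ℕ} (A B : Finset (Fin n)) :
    ∑ y : Bits n, character A y * character B y = if A = B then 2 ^ n else 0 := by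
  split_ifs with h
  · subst h
    simp [← pow_two, character_sq]
  · have e : ∀ (C : Finset (Fin n)) (y : Bits n),
        character C y = ∏ k, if k ∈ C then (if y k then (-1 : ℝ) else 1) else 1 := by
      intro C y
      rw [Finset.prod_ite_mem, Finset.univ_inter]; rfl
    simp only [e, ← Finset.prod_mul_distrib]
    rw [sum_prod_bits (fun k b => (if k ∈ A then (if b then (-1 : ℝ) else 1) else 1) *
      if k ∈ B then (if b then (-1 : ℝ) else 1) else 1)]
    obtain ⟨k, hk⟩ : ∃ k, ¬ (k ∈ A ↔ k ∈ B) := by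
      by_contra! hc; exact h (Finset.ext hc)
    refine Finset.prod_eq_zero (Finset.mem_univ k) ?_
    by_cases hA : k ∈ A <;> by_cases hB : k ∈ B <;> simp_all

theorem sum_character {n : ℕ} {A : Finset (Fin n)} (hA : A.Nonempty) :
    ∑ y : Bits n, character A y = 0 := by
  have h := sum_character_mul A ∅
  rw [if_neg hA.ne_empty] at h
  simpa [character] using h

/-- Expanding the square, orthogonality kills the terms with distinct hyperedges. -/
theorem sum_sq_sum_character {D n : ℕ} (F : Finset (Hyperedge D n)) :
    ∑ y : Bits n, (∑ S ∈ F, character S.1 y) ^ 2 = 2 ^ n * F.card := by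
  simp only [pow_two, Finset.sum_mul_sum]
  rw [Finset.sum_comm]
  have : ∀ S ∈ F, ∑ y : Bits n, ∑ S' ∈ F, character S.1 y * character S'.1 y = 2 ^ n := by
    intro S hS
    rw [Finset.sum_comm]
    simp only [sum_character_mul, ← Subtype.ext_iff]
    rw [Finset.sum_ite_eq, if_pos hS]
  rw [Finset.sum_congr rfl this]
  simp [mul_comm]

/-- A sum of distinct spin products is of the order of the square root of the number of terms. -/
theorem mean_abs_sum_character_le {D n : ℕ} (F : Finset (Hyperedge D n)) :
    (2 ^ n : ℝ)⁻¹ * ∑ y : Bits n, |∑ S ∈ F, character S.1 y| ≤ Real.sqrt F.card := by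
  refine Real.le_sqrt_of_sq_le ?_
  have h := sq_sum_le_card_mul_sum_sq (s := (Finset.univ : Finset (Bits n)))
    (f := fun y => |∑ S ∈ F, character S.1 y|)
  simp only [sq_abs, sum_sq_sum_character] at h
  have hc : ((Finset.univ : Finset (Bits n)).card : ℝ) = 2 ^ n := by simp
  rw [hc] at h
  rw [mul_pow, inv_pow, inv_mul_le_iff₀ (by positivity)]
  nlinarith

/-! ### Counting the hyperedges that meet a set in an odd number of sites. -/

theorem card_hyperedge_filter_superset (D n : ℕ) (U : Finset (Fin n)) (hU : U.card ≤ D) :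
    (Finset.univ.filter fun S : Hyperedge D n => U ⊆ S.1).card
      = (n - U.card).choose (D - U.card) := by
  have : (n - U.card).choose (D - U.card) = ((Uᶜ).powersetCard (D - U.card)).card := by
    rw [Finset.card_powersetCard, Finset.card_compl, Fintype.card_fin]
  rw [this]
  refine Finset.card_bij (fun S _ => S.1 \ U) ?_ ?_ ?_
  · intro S hS
    rw [Finset.mem_filter] at hS
    rw [Finset.mem_powersetCard, Finset.card_sdiff_of_subset hS.2, S.2]
    exact ⟨fun k hk => by simp at hk ⊢; exact hk.2, rfl⟩
  · intro S hS S' hS' h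
    rw [Finset.mem_filter] at hS hS'
    ext1
    rw [← Finset.sdiff_union_of_subset hS.2, ← Finset.sdiff_union_of_subset hS'.2, h]
  · intro V hV
    rw [Finset.mem_powersetCard] at hV
    have hd : Disjoint V U := by
      rw [Finset.disjoint_left]
      exact fun k hk => Finset.mem_compl.1 (hV.1 hk)
    refine ⟨⟨V ∪ U, ?_⟩, ?_, ?_⟩
    · rw [Finset.card_union_of_disjoint hd, hV.2, Nat.sub_add_cancel hU]
    · simp
    · exact Finset.union_sdiff_cancel_right hd

theorem sum_card_inter {D n : ℕ} (hD : 1 ≤ D) (T : Finset (Fin n)) :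
    ∑ S : Hyperedge D n, (S.1 ∩ T).card = T.card * (n - 1).choose (D - 1) := by
  have h : ∀ S : Hyperedge D n, (S.1 ∩ T).card = ∑ k ∈ T, if {k} ⊆ S.1 then 1 else 0 := by
    intro S
    rw [Finset.inter_comm, ← Finset.filter_mem_eq_inter, Finset.card_filter]
    simp
  simp only [h]
  rw [Finset.sum_comm]
  simp only [← Finset.card_filter]
  rw [Finset.sum_congr rfl fun k _ => card_hyperedge_filter_superset D n {k} (by simpa using hD)]
  simp

/-- Double counting of ordered pairs of distinct sites of `T` inside a hyperedge. Such hyperedges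
are rarer by a factor of order `n` than those containing one given site, so multiple intersections
are negligible. -/
theorem sum_card_inter_mul_pred {D n : ℕ} (hD : 2 ≤ D) (T : Finset (Fin n)) :
    ∑ S : Hyperedge D n, (S.1 ∩ T).card * ((S.1 ∩ T).card - 1)
      ≤ T.card ^ 2 * (n - 2).choose (D - 2) := by
  have h : ∀ S : Hyperedge D n, (S.1 ∩ T).card * ((S.1 ∩ T).card - 1)
      = ∑ p ∈ T.offDiag, if {p.1, p.2} ⊆ S.1 then 1 else 0 := by
    intro S
    rw [← Finset.card_filter, Nat.mul_sub_one, ← Finset.offDiag_card]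
    congr 1
    ext p
    simp only [Finset.mem_offDiag, Finset.mem_filter, Finset.insert_subset_iff,
      Finset.singleton_subset_iff, Finset.mem_inter]
    tauto
  simp only [h]
  rw [Finset.sum_comm]
  simp only [← Finset.card_filter]
  have h2 : ∀ p ∈ T.offDiag, (Finset.univ.filter fun S : Hyperedge D n => {p.1, p.2} ⊆ S.1).card
      = (n - 2).choose (D - 2) := by
    intro p hp
    have hc : ({p.1, p.2} : Finset (Fin n)).card = 2 :=
      Finset.card_pair (Finset.mem_offDiag.1 hp).2.2
    rw [card_hyperedge_filter_superset D n _ (by rwa [hc]), hc]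
  rw [Finset.sum_congr rfl h2, Finset.sum_const, smul_eq_mul, Finset.offDiag_card, pow_two]
  exact Nat.mul_le_mul_right _ (Nat.sub_le _ _)

/-- The hyperedges other than `S` that meet `T` in an odd number of sites. -/
def oddNeighbours {D n : ℕ} (S : Hyperedge D n) (T : Finset (Fin n)) : Finset (Hyperedge D n) :=
  (Finset.univ.erase S).filter fun S' => Odd (S'.1 ∩ T).card

theorem card_oddNeighbours_le {D n : ℕ} (hD : 1 ≤ D) (S : Hyperedge D n) (T : Finset (Fin n)) :
    (oddNeighbours S T).card ≤ T.card * (n - 1).choose (D - 1) := by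
  rw [← sum_card_inter hD, oddNeighbours, Finset.card_filter]
  refine (Finset.sum_le_sum_of_subset (Finset.subset_univ _)).trans
    (Finset.sum_le_sum fun S' _ => ?_)
  split_ifs with h
  · exact h.pos
  · exact Nat.zero_le _

/-- Sum over hyperedges of `m ≤ [m odd] + m (m - 1)` with `m = |S' ∩ T|`. The `+ 1` accounts for `S`
itself, which is not its own neighbour. -/
theorem le_card_oddNeighbours {D n : ℕ} (hD : 2 ≤ D) (S : Hyperedge D n) (T : Finset (Fin n)) :
    T.card * (n - 1).choose (D - 1)
      ≤ (oddNeighbours S T).card + 1 + T.card ^ 2 * (n - 2).choose (D - 2) := by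
  have h1 : (Finset.univ.filter fun S' : Hyperedge D n => Odd (S'.1 ∩ T).card).card
      ≤ (oddNeighbours S T).card + 1 := by
    rw [oddNeighbours, Finset.filter_erase]
    have := Finset.pred_card_le_card_erase (a := S)
      (s := Finset.univ.filter fun S' : Hyperedge D n => Odd (S'.1 ∩ T).card)
    omega
  rw [← sum_card_inter (by omega)]
  refine le_trans ?_ (Nat.add_le_add h1 (sum_card_inter_mul_pred hD T))
  rw [Finset.card_filter, ← Finset.sum_add_distrib]
  refine Finset.sum_le_sum fun S' _ => ?_
  generalize (S'.1 ∩ T).card = m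
  rcases m with _ | _ | m
  · simp
  · simp
  · have : (m + 1 + 1) * 1 ≤ (m + 1 + 1) * (m + 1 + 1 - 1) := Nat.mul_le_mul_left _ (by omega)
    omega

/-! ### The flip expectation at finite size. -/

theorem charFun_character_mul {n : ℕ} {μ : Measure ℝ} {γ : ℝ} {l : ℂ}
    (hl : charFun μ γ = Complex.exp l) (S : Finset (Fin n)) (y : Bits n) :
    charFun μ (γ * character S y)
      = Complex.exp (l.re + Complex.I * (l.im * character S y : ℝ)) := by
  rcases character_eq_or S y with h | h
  · rw [h, mul_one, hl]
    congr 1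
    apply Complex.ext <;> simp
  · rw [h, mul_neg_one, charFun_neg, hl, ← Complex.exp_conj]
    congr 1
    apply Complex.ext <;> simp

theorem prod_charFun_phaseCoeff {D n : ℕ} {μ : Measure ℝ} [IsProbabilityMeasure μ] {γ : ℝ} {l : ℂ}
    (hl : charFun μ γ = Complex.exp l) (S : Hyperedge D n) (T : Finset (Fin n)) (y : Bits n) :
    ∏ S' ∈ Finset.univ.erase S, charFun μ (phaseCoeff γ T y S')
      = (Real.exp ((oddNeighbours S T).card * l.re) : ℂ) * Complex.exp (Complex.I *
        (l.im * ∑ S' ∈ oddNeighbours S T, character S'.1 y : ℝ)) := by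
  have h : ∀ S' : Hyperedge D n, charFun μ (phaseCoeff γ T y S')
      = if Odd (S'.1 ∩ T).card then
          Complex.exp (l.re + Complex.I * (l.im * character S'.1 y : ℝ)) else 1 := by
    intro S'
    rw [phaseCoeff]
    split_ifs
    · exact charFun_character_mul hl _ _
    · simp
  simp only [h]
  rw [← Finset.prod_filter, ← oddNeighbours, ← Complex.exp_sum, Complex.ofReal_exp,
    ← Complex.exp_add, Finset.sum_add_distrib]
  simp [Finset.mul_sum]

/-- Changing the sign of the argument conjugates the moment, so multiplying by the character moves
the sign from the imaginary to the real part. Averaging over `y` then leaves only the imaginary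
part. -/
theorem character_mul_momentFun {D n : ℕ} (μ : Measure ℝ) (γ : ℝ) (S : Hyperedge D n)
    (T : Finset (Fin n)) (y : Bits n) :
    (character S.1 y : ℂ) * momentFun μ (phaseCoeff γ T y S)
      = character S.1 y * (momentFun μ (if Odd (S.1 ∩ T).card then γ else 0)).re
        + Complex.I * (momentFun μ (if Odd (S.1 ∩ T).card then γ else 0)).im := by
  have h : phaseCoeff γ T y S
      = (if Odd (S.1 ∩ T).card then γ else 0) * character S.1 y := by
    rw [phaseCoeff]; split_ifs <;> simp
  rw [h]
  generalize (if Odd (S.1 ∩ T).card then γ else 0) = g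
  rcases character_eq_or S.1 y with h | h
  · rw [h, mul_one]
    apply Complex.ext <;> simp
  · rw [h, mul_neg_one, momentFun_neg]
    apply Complex.ext <;> simp

/-- Up to fluctuations of the phase, the flip expectation is the imaginary part of the moment
times the modulus of the characteristic function to the number of odd neighbours. -/
theorem norm_flipMean_sub_le {D n : ℕ} (hD : 1 ≤ D) {μ : Measure ℝ} [IsProbabilityMeasure μ]
    {γ : ℝ} {l : ℂ} (hl : charFun μ γ = Complex.exp l) (S : Hyperedge D n)
    (T : Finset (Fin n)) :
    ‖flipMean μ γ S T - Complex.I * (momentFun μ (if Odd (S.1 ∩ T).card then γ else 0)).im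
        * Real.exp ((oddNeighbours S T).card * l.re)‖
      ≤ ‖momentFun μ (if Odd (S.1 ∩ T).card then γ else 0)‖ * (|l.im|
        * Real.sqrt (oddNeighbours S T).card) := by
  have hre : l.re ≤ 0 := by
    have h := norm_charFun_le_one (μ := μ) γ
    rwa [hl, Complex.norm_exp, Real.exp_le_one_iff] at h
  set a := momentFun μ (if Odd (S.1 ∩ T).card then γ else 0) with ha
  set v := Real.exp ((oddNeighbours S T).card * l.re) with hv
  set M : Bits n → ℝ := fun y => ∑ S' ∈ oddNeighbours S T, character S'.1 y with hM
  have hv1 : v ≤ 1 := Real.exp_le_one_iff.2 (mul_nonpos_of_nonneg_of_nonpos (by positivity) hre)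
  have hS : S.1.Nonempty := Finset.card_pos.1 (by rw [S.2]; omega)
  have h2 : (2 ^ n : ℂ) ≠ 0 := pow_ne_zero _ two_ne_zero
  -- With the phase replaced by 1 the average over `y` is exactly `i Im a · v`; the error is
  -- therefore the average with `exp(iθ) - 1` in place of the phase, bounded below by `|exp(iθ) - 1|
  -- ≤ |θ|`.
  have e : flipMean μ γ S T - Complex.I * a.im * v = (2 ^ n : ℂ)⁻¹ * ∑ y : Bits n,
      ((character S.1 y : ℂ) * momentFun μ (phaseCoeff γ T y S)) *
        (v * (Complex.exp (Complex.I * (l.im * M y : ℝ)) - 1)) := by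
    have h0 : ∑ y : Bits n, ((character S.1 y : ℂ) * momentFun μ (phaseCoeff γ T y S)) * v
        = 2 ^ n * (Complex.I * a.im * v) := by
      simp only [character_mul_momentFun, ← ha, add_mul]
      rw [Finset.sum_add_distrib, ← Finset.sum_mul, ← Finset.sum_mul, ← Complex.ofReal_sum,
        sum_character hS]
      simp
    rw [flipMean]
    simp only [prod_charFun_phaseCoeff hl, ← hv, mul_sub, mul_one, Finset.sum_sub_distrib]
    rw [h0, inv_mul_cancel_left₀ h2]
    congr 2
    exact Finset.sum_congr rfl fun y _ => by ring
  rw [e, norm_mul]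
  have hn : ‖(2 ^ n : ℂ)⁻¹‖ = (2 ^ n : ℝ)⁻¹ := by simp
  rw [hn]
  calc _ ≤ (2 ^ n : ℝ)⁻¹ * ∑ y : Bits n, ‖a‖ * (|l.im| * |M y|) := by
        gcongr
        refine norm_sum_le_of_le _ fun y _ => ?_
        rw [norm_mul]
        have hc : ‖(character S.1 y : ℂ) * momentFun μ (phaseCoeff γ T y S)‖ = ‖a‖ := by
          rw [character_mul_momentFun, ← ha]
          rcases character_eq_or S.1 y with h | h <;> rw [h]
          · congr 1; apply Complex.ext <;> simp
          · rw [← Complex.norm_conj a, ← norm_neg]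
            congr 1; apply Complex.ext <;> simp
        rw [hc, norm_mul, Complex.norm_real, Real.norm_of_nonneg (Real.exp_pos _).le]
        refine mul_le_mul_of_nonneg_left ?_ (norm_nonneg _)
        calc _ ≤ 1 * ‖l.im * M y‖ :=
              mul_le_mul hv1 Real.norm_exp_I_mul_ofReal_sub_one_le (norm_nonneg _) zero_le_one
          _ = |l.im| * |M y| := by rw [one_mul, Real.norm_eq_abs, abs_mul]
    _ = ‖a‖ * (|l.im| * ((2 ^ n : ℝ)⁻¹ * ∑ y : Bits n, |M y|)) := by
        rw [← Finset.mul_sum, ← Finset.mul_sum]; ring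
    _ ≤ _ := by
        gcongr
        exact mean_abs_sum_character_le _

/-! ### The infinite-size limit for general i.i.d. couplings. -/

theorem tendsto_choose_div_pow (k : ℕ) :
    Tendsto (fun n : ℕ => (n.choose k : ℝ) / n ^ k) atTop (𝓝 (1 / k !)) := by
  have h := isEquivalent_choose k
  have hne : ∀ᶠ n : ℕ in atTop, ((n : ℝ) ^ k / k !) ≠ 0 := by
    filter_upwards [eventually_gt_atTop 0] with n hn
    positivity
  have h1 := (Asymptotics.isEquivalent_iff_tendsto_one hne).1 h
  have h2 := h1.mul_const (1 / (k ! : ℝ))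
  rw [one_mul] at h2
  refine h2.congr' ?_
  filter_upwards [eventually_gt_atTop 0] with n hn
  have : (k ! : ℝ) ≠ 0 := by positivity
  have : (n : ℝ) ≠ 0 := by positivity
  simp only [Pi.div_apply]
  field_simp

theorem tendsto_choose_pred_div_pow (k : ℕ) :
    Tendsto (fun n : ℕ => ((n - 1).choose k : ℝ) / n ^ k) atTop (𝓝 (1 / k !)) := by
  have h := (tendsto_choose_div_pow (k + 1)).const_mul ((k : ℝ) + 1)
  have e : ((k : ℝ) + 1) * (1 / (k + 1)!) = 1 / k ! := by
    rw [Nat.factorial_succ]; push_cast; field_simp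
  rw [e] at h
  refine h.congr' ?_
  filter_upwards [eventually_gt_atTop 0] with n hn
  obtain ⟨m, rfl⟩ : ∃ m, n = m + 1 := ⟨n - 1, by omega⟩
  have h2 : ((m : ℝ) + 1) * m.choose k = (m + 1).choose (k + 1) * (k + 1) := by
    exact_mod_cast Nat.add_one_mul_choose_eq m k
  have h3 : (m : ℝ) + 1 ≠ 0 := by positivity
  rw [Nat.add_sub_cancel]
  push_cast
  rw [mul_div_assoc', mul_comm, ← h2, pow_succ]
  field_simp

theorem abs_exp_sub_exp_le {x y : ℝ} (hx : x ≤ 0) (hy : y ≤ 0) :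
    |Real.exp x - Real.exp y| ≤ |x - y| := by
  wlog h : x ≤ y generalizing x y
  · rw [abs_sub_comm, abs_sub_comm x]
    exact this hy hx (le_of_not_ge h)
  rw [abs_sub_comm, abs_sub_comm x, abs_of_nonneg (sub_nonneg.2 (Real.exp_le_exp.2 h)),
    abs_of_nonneg (sub_nonneg.2 h)]
  have h1 := Real.add_one_le_exp (x - y)
  have h2 : Real.exp x = Real.exp (x - y) * Real.exp y := by rw [← Real.exp_add]; ring_nf
  have h3 := Real.exp_le_one_iff.2 hy
  have h4 := Real.exp_pos y
  nlinarith

theorem momentFun_zero_im (μ : Measure ℝ) : (momentFun μ 0).im = 0 := by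
  have h := momentFun_neg μ 0
  rw [neg_zero] at h
  exact Complex.conj_eq_iff_im.1 h.symm

/-- The number of odd neighbours times the log-modulus of the characteristic function depends on
the flip set, in the limit, only through its size. -/
theorem abs_card_oddNeighbours_mul_sub_le {D n : ℕ} (hD : 2 ≤ D) (hn : 0 < n) (S : Hyperedge D n)
    {T : Finset (Fin n)} (hT : T.card ≤ D) (r lam : ℝ) :
    |(oddNeighbours S T).card * r - T.card * lam|
      ≤ (D ^ 2 + 1) * (|(n : ℝ) ^ (D - 1) * r| / n)
        + D * |((n - 1).choose (D - 1) : ℝ) * r - lam| := by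
  have h1 : ((oddNeighbours S T).card : ℝ) ≤ T.card * (n - 1).choose (D - 1) := by
    exact_mod_cast card_oddNeighbours_le (by omega) S T
  have h2 : (T.card * (n - 1).choose (D - 1) : ℝ)
      ≤ (oddNeighbours S T).card + 1 + T.card ^ 2 * (n - 2).choose (D - 2) := by
    exact_mod_cast le_card_oddNeighbours hD S T
  have hT' : (T.card : ℝ) ≤ D := by exact_mod_cast hT
  have hn0 : (n : ℝ) ≠ 0 := by positivity
  have hn1 : (1 : ℝ) ≤ n := by exact_mod_cast hn
  have h3 : ((n - 2).choose (D - 2) : ℝ) ≤ (n : ℝ) ^ (D - 2) := by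
    exact_mod_cast (Nat.choose_le_pow _ _).trans (Nat.pow_le_pow_left (Nat.sub_le _ _) _)
  have h4 : (1 : ℝ) ≤ (n : ℝ) ^ (D - 2) := one_le_pow₀ hn1
  have h5 : |(n : ℝ) ^ (D - 1) * r| / n = (n : ℝ) ^ (D - 2) * |r| := by
    rw [show D - 1 = (D - 2) + 1 by omega, pow_succ, abs_mul, abs_of_nonneg (by positivity)]
    field_simp
  -- The two counting bounds leave a gap of at most `1 + D² n^(D-2)`, and `1 ≤ n^(D-2)`.
  have h6 : |((oddNeighbours S T).card - T.card * (n - 1).choose (D - 1) : ℝ)|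
      ≤ (D ^ 2 + 1) * (n : ℝ) ^ (D - 2) := by
    have : (T.card : ℝ) ^ 2 * (n - 2).choose (D - 2) ≤ D ^ 2 * (n : ℝ) ^ (D - 2) := by gcongr
    rw [abs_sub_comm, abs_of_nonneg (by linarith)]
    nlinarith
  have e : (oddNeighbours S T).card * r - T.card * lam
      = ((oddNeighbours S T).card - T.card * (n - 1).choose (D - 1)) * r
        + T.card * ((n - 1).choose (D - 1) * r - lam) := by ring
  rw [e, h5]
  refine (abs_add_le _ _).trans (add_le_add ?_ ?_)
  · rw [abs_mul, ← mul_assoc]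
    gcongr
  · rw [abs_mul, Nat.abs_cast]
    gcongr

/-- The limit of the rescaled flip expectation of a set of `t` sites. -/
def limitFlip (a : ℂ) (lam : ℝ) (t : ℕ) : ℂ :=
  if Odd t then Complex.I * a.im * Real.exp (t * lam) else 0

/-- A bound on the distance of the rescaled flip expectations to their limits. -/
def flipError (D n : ℕ) (μ : Measure ℝ) (γ : ℝ) (l a : ℂ) (lam : ℝ) : ℝ :=
  (n : ℝ) ^ (D - 1) * (‖momentFun μ γ‖ + ‖momentFun μ 0‖)
      * Real.sqrt (D * ((n : ℝ) ^ (D - 1) * l.im ^ 2))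
    + |(n : ℝ) ^ (D - 1) * (momentFun μ γ).im - a.im|
    + |a.im| * ((D ^ 2 + 1) * (|(n : ℝ) ^ (D - 1) * l.re| / n)
        + D * |((n - 1).choose (D - 1) : ℝ) * l.re - lam|)

theorem norm_pow_mul_flipMean_sub_le {D n : ℕ} (hD : 2 ≤ D) (hn : 0 < n) {μ : Measure ℝ}
    [IsProbabilityMeasure μ] {γ : ℝ} {l : ℂ} (hl : charFun μ γ = Complex.exp l)
    (a : ℂ) {lam : ℝ} (hlam : lam ≤ 0) (S : Hyperedge D n) {T : Finset (Fin n)} (hT : T ⊆ S.1) :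
    ‖(n : ℂ) ^ (D - 1) * flipMean μ γ S T - limitFlip a lam T.card‖
      ≤ flipError D n μ γ l a lam := by
  have hre : l.re ≤ 0 := by
    have h := norm_charFun_le_one (μ := μ) γ
    rwa [hl, Complex.norm_exp, Real.exp_le_one_iff] at h
  have hTD : T.card ≤ D := S.2 ▸ Finset.card_le_card hT
  have hb := norm_flipMean_sub_le (by omega) hl S T
  rw [Finset.inter_eq_right.2 hT] at hb
  have hN : |l.im| * Real.sqrt (oddNeighbours S T).card
      ≤ Real.sqrt (D * ((n : ℝ) ^ (D - 1) * l.im ^ 2)) := by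
    rw [← Real.sqrt_sq_eq_abs, ← Real.sqrt_mul (sq_nonneg _)]
    refine Real.sqrt_le_sqrt ?_
    have h1 : (oddNeighbours S T).card ≤ D * n ^ (D - 1) :=
      (card_oddNeighbours_le (by omega) S T).trans (Nat.mul_le_mul hTD
        ((Nat.choose_le_pow _ _).trans (Nat.pow_le_pow_left (Nat.sub_le _ _) _)))
    have h2 : ((oddNeighbours S T).card : ℝ) ≤ D * (n : ℝ) ^ (D - 1) := by exact_mod_cast h1
    nlinarith [sq_nonneg l.im]
  have hpow : ‖(n : ℂ) ^ (D - 1)‖ = (n : ℝ) ^ (D - 1) := by simp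
  have hcard := abs_card_oddNeighbours_mul_sub_le hD hn S hTD l.re lam
  rw [flipError]
  set δ := (D ^ 2 + 1) * (|(n : ℝ) ^ (D - 1) * l.re| / n)
        + D * |((n - 1).choose (D - 1) : ℝ) * l.re - lam| with hδ
  set q := Real.sqrt (D * ((n : ℝ) ^ (D - 1) * l.im ^ 2)) with hq
  have hδ0 : 0 ≤ δ := (abs_nonneg _).trans hcard
  have hq0 : 0 ≤ q := Real.sqrt_nonneg _
  set v := Real.exp ((oddNeighbours S T).card * l.re) with hv
  -- The moment is taken at `γ` or at `0` according to the parity of `|T|`; the sum of both norms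
  -- covers the two cases.
  have hbound : ∀ b : ℂ, ‖b‖ ≤ ‖momentFun μ γ‖ + ‖momentFun μ 0‖ →
      ‖flipMean μ γ S T - Complex.I * b.im * v‖
        ≤ ‖b‖ * (|l.im| * Real.sqrt (oddNeighbours S T).card) →
      ‖(n : ℂ) ^ (D - 1) * flipMean μ γ S T - (n : ℂ) ^ (D - 1) * (Complex.I * b.im * v)‖
        ≤ (n : ℝ) ^ (D - 1) * (‖momentFun μ γ‖ + ‖momentFun μ 0‖) * q := by
    intro b hb1 hb2
    rw [← mul_sub, norm_mul, hpow, mul_assoc ((n : ℝ) ^ (D - 1))]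
    refine mul_le_mul_of_nonneg_left (hb2.trans ?_) (by positivity)
    gcongr
  rw [limitFlip]
  split_ifs with ho
  · rw [if_pos ho] at hb
    have h1 := hbound _ (by linarith [norm_nonneg (momentFun μ 0)]) hb
    have hv1 : v ≤ 1 :=
      Real.exp_le_one_iff.2 (mul_nonpos_of_nonneg_of_nonpos (by positivity) hre)
    have h2 : ‖(n : ℂ) ^ (D - 1) * (Complex.I * (momentFun μ γ).im * v)
        - Complex.I * a.im * Real.exp (T.card * lam)‖
        ≤ |(n : ℝ) ^ (D - 1) * (momentFun μ γ).im - a.im| + |a.im| * δ := by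
      have e : (n : ℂ) ^ (D - 1) * (Complex.I * (momentFun μ γ).im * v)
          - Complex.I * a.im * Real.exp (T.card * lam)
          = Complex.I * (((n : ℝ) ^ (D - 1) * (momentFun μ γ).im - a.im) * v
            + a.im * (v - Real.exp (T.card * lam)) : ℝ) := by
        push_cast; ring
      rw [e, norm_mul, Complex.norm_I, one_mul, Complex.norm_real, Real.norm_eq_abs]
      refine (abs_add_le _ _).trans (add_le_add ?_ ?_)
      · rw [abs_mul, abs_of_nonneg (Real.exp_pos _).le]
        exact mul_le_of_le_one_right (abs_nonneg _) hv1
      · rw [abs_mul]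
        gcongr
        exact (abs_exp_sub_exp_le (mul_nonpos_of_nonneg_of_nonpos (by positivity) hre)
          (mul_nonpos_of_nonneg_of_nonpos (by positivity) hlam)).trans hcard
    calc _ ≤ _ := norm_sub_le_norm_sub_add_norm_sub _
          ((n : ℂ) ^ (D - 1) * (Complex.I * (momentFun μ γ).im * v)) _
      _ ≤ _ := by rw [add_assoc]; exact add_le_add h1 h2
  -- For even `|T|` the moment is taken at `0`, where it is real, so the main term vanishes.
  · rw [if_neg ho] at hb
    have h1 := hbound _ (by linarith [norm_nonneg (momentFun μ γ)]) hb
    rw [momentFun_zero_im] at h1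
    simp only [Complex.ofReal_zero, mul_zero, zero_mul] at h1
    have h3 := mul_nonneg (abs_nonneg a.im) hδ0
    have h4 := abs_nonneg ((n : ℝ) ^ (D - 1) * (momentFun μ γ).im - a.im)
    linarith

/-- The infinite-size energy per site in terms of the limits of the rescaled transforms. -/
def limitEnergy (D : ℕ) (β : ℝ) (a : ℂ) (lam : ℝ) : ℂ :=
  ∑ t ∈ Finset.range (D + 1), D.choose t • (flipWeight D β t * limitFlip a lam t)

/-- Every hyperedge has the same limiting contribution, since that depends only on the sizes of its
flip sets. Of the scaling `n^D`, the factor `n^(D-1)` rescales the flip expectation and the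
remaining `n` is the number of sites. -/
theorem norm_integral_energy_sub_le {D n : ℕ} (hD : 2 ≤ D) (hn : 0 < n) {μ : Measure ℝ}
    [IsProbabilityMeasure μ] (hμ : Integrable (fun x : ℝ => x) μ) (β : ℝ) {γ : ℝ} {l : ℂ}
    (hl : charFun μ γ = Complex.exp l) (a : ℂ) {lam : ℝ} (hlam : lam ≤ 0) :
    ‖(∫ J : Hyperedge D n → ℝ, energy J β γ ∂(Measure.pi fun _ => μ)) / n
        - ((n.choose D : ℝ) / (n : ℝ) ^ D : ℝ) * limitEnergy D β a lam‖
      ≤ (n.choose D : ℝ) / (n : ℝ) ^ D *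
        ((∑ t ∈ Finset.range (D + 1), D.choose t • ‖flipWeight D β t‖)
          * flipError D n μ γ l a lam) := by
  have hn0 : (n : ℂ) ≠ 0 := by exact_mod_cast hn.ne'
  have hpow : (n : ℂ) ^ D = n ^ (D - 1) * n := by rw [← pow_succ]; congr 1; omega
  have hcard : (Finset.univ : Finset (Hyperedge D n)).card = n.choose D := by
    simp
  have e1 : (∫ J : Hyperedge D n → ℝ, energy J β γ ∂(Measure.pi fun _ => μ)) / n
      = ((n : ℝ) ^ D : ℝ)⁻¹ * ∑ S : Hyperedge D n, ∑ T ∈ S.1.powerset,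
        flipWeight D β T.card * ((n : ℂ) ^ (D - 1) * flipMean μ γ S T) := by
    rw [integral_energy β γ hμ]
    have h : ∀ (S : Hyperedge D n) (T : Finset (Fin n)), flipWeight D β T.card *
        ((n : ℂ) ^ (D - 1) * flipMean μ γ S T)
        = (n : ℂ) ^ (D - 1) * (flipWeight D β T.card * flipMean μ γ S T) := fun S T => by ring
    simp only [h, ← Finset.mul_sum]
    push_cast
    rw [hpow]
    field_simp
  have e2 : (((n.choose D : ℝ) / (n : ℝ) ^ D : ℝ) : ℂ) * limitEnergy D β a lam
      = ((n : ℝ) ^ D : ℝ)⁻¹ * ∑ S : Hyperedge D n, ∑ T ∈ S.1.powerset,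
        flipWeight D β T.card * limitFlip a lam T.card := by
    have h : ∀ S : Hyperedge D n, ∑ T ∈ S.1.powerset,
        flipWeight D β T.card * limitFlip a lam T.card = limitEnergy D β a lam := by
      intro S
      rw [Finset.sum_powerset_apply_card (fun t => flipWeight D β t * limitFlip a lam t), S.2,
        limitEnergy]
    simp only [h]
    rw [Finset.sum_const, hcard, nsmul_eq_mul]
    push_cast
    ring
  rw [e1, e2, ← mul_sub, ← Finset.sum_sub_distrib, norm_mul,
    Complex.norm_real, Real.norm_of_nonneg (by positivity), div_eq_inv_mul, mul_assoc]
  gcongr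
  rw [← hcard, ← nsmul_eq_mul]
  refine (norm_sum_le _ _).trans (Finset.sum_le_card_nsmul _ _ _ fun S _ => ?_)
  rw [← Finset.sum_sub_distrib]
  have h : ∑ t ∈ Finset.range (D + 1), D.choose t • ‖flipWeight D β t‖
      = ∑ T ∈ S.1.powerset, ‖flipWeight D β T.card‖ := by
    rw [Finset.sum_powerset_apply_card (fun t => ‖flipWeight D β t‖), S.2]
  rw [h, Finset.sum_mul]
  refine norm_sum_le_of_le _ fun T hT => ?_
  rw [← mul_sub, norm_mul]
  gcongr
  exact norm_pow_mul_flipMean_sub_le hD hn hl a hlam S (Finset.mem_powerset.1 hT)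

/-- The infinite-size energy of i.i.d. couplings, from the limits of the rescaled logarithm of the
characteristic function and of the rescaled first-moment transform. -/
theorem tendsto_integral_energy {D : ℕ} (hD : 2 ≤ D) (β γ : ℝ) (μ : ℕ → Measure ℝ)
    [∀ n, IsProbabilityMeasure (μ n)] (hμ : ∀ n, Integrable (fun x : ℝ => x) (μ n)) (l : ℕ → ℂ)
    (hl : ∀ᶠ n in atTop, charFun (μ n) γ = Complex.exp (l n)) {lam : ℝ} (hlam : lam ≤ 0) {a m : ℂ}
    (hre : Tendsto (fun n : ℕ => (n : ℝ) ^ (D - 1) * (l n).re) atTop (𝓝 ((D - 1)! * lam)))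
    (him : Tendsto (fun n : ℕ => (n : ℝ) ^ (D - 1) * (l n).im ^ 2) atTop (𝓝 0))
    (ha : Tendsto (fun n : ℕ => (n : ℂ) ^ (D - 1) * momentFun (μ n) γ) atTop (𝓝 a))
    (hm : Tendsto (fun n : ℕ => (n : ℂ) ^ (D - 1) * momentFun (μ n) 0) atTop (𝓝 m)) :
    Tendsto (fun n : ℕ =>
        (∫ J : Hyperedge D n → ℝ, energy J β γ ∂(Measure.pi fun _ => μ n)) / (n : ℂ))
      atTop (𝓝 ((1 / D ! : ℝ) * limitEnergy D β a lam)) := by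
  have herr : Tendsto (fun n => flipError D n (μ n) γ (l n) a lam) atTop (𝓝 0) := by
    have h1 : Tendsto (fun n : ℕ => (n : ℝ) ^ (D - 1) *
        (‖momentFun (μ n) γ‖ + ‖momentFun (μ n) 0‖)) atTop (𝓝 (‖a‖ + ‖m‖)) := by
      refine (ha.norm.add hm.norm).congr fun n => ?_
      simp [mul_add]
    have h2 : Tendsto (fun n : ℕ => Real.sqrt (D * ((n : ℝ) ^ (D - 1) * (l n).im ^ 2)))
        atTop (𝓝 0) := by
      simpa using! (him.const_mul (D : ℝ)).sqrt
    have h3 : Tendsto (fun n : ℕ => |(n : ℝ) ^ (D - 1) * (momentFun (μ n) γ).im - a.im|)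
        atTop (𝓝 0) := by
      have h := (Complex.continuous_im.tendsto a).comp ha
      have h' : Tendsto (fun n : ℕ => (n : ℝ) ^ (D - 1) * (momentFun (μ n) γ).im) atTop
          (𝓝 a.im) := by
        refine h.congr fun n => ?_
        simp only [Function.comp_apply]
        rw [← Complex.ofReal_natCast, ← Complex.ofReal_pow, Complex.im_ofReal_mul]
      simpa using (h'.sub_const a.im).abs
    have h4 : Tendsto (fun n : ℕ => |(n : ℝ) ^ (D - 1) * (l n).re| / n) atTop (𝓝 0) :=
      hre.abs.div_atTop tendsto_natCast_atTop_atTop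
    have h5 : Tendsto (fun n : ℕ => |((n - 1).choose (D - 1) : ℝ) * (l n).re - lam|) atTop
        (𝓝 0) := by
      have h := (tendsto_choose_pred_div_pow (D - 1)).mul hre
      have e : (1 / ((D - 1)! : ℝ)) * ((D - 1)! * lam) = lam := by
        have : ((D - 1)! : ℝ) ≠ 0 := by positivity
        field_simp
      rw [e] at h
      have h' : Tendsto (fun n : ℕ => ((n - 1).choose (D - 1) : ℝ) * (l n).re) atTop (𝓝 lam) := by
        refine h.congr' ?_
        filter_upwards [eventually_gt_atTop 0] with n hn
        have : (n : ℝ) ≠ 0 := by positivity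
        field_simp
      simpa using (h'.sub_const lam).abs
    have h := ((h1.mul h2).add h3).add
      (((h4.const_mul ((D : ℝ) ^ 2 + 1)).add (h5.const_mul (D : ℝ))).const_mul |a.im|)
    simpa [flipError] using! h
  have hch := tendsto_choose_div_pow D
  have hmain : Tendsto (fun n : ℕ => (((n.choose D : ℝ) / (n : ℝ) ^ D : ℝ) : ℂ)
      * limitEnergy D β a lam) atTop (𝓝 ((1 / D ! : ℝ) * limitEnergy D β a lam)) :=
    ((Complex.continuous_ofReal.tendsto _).comp hch).mul_const _
  have hbd := hch.mul (herr.const_mul (∑ t ∈ Finset.range (D + 1), D.choose t • ‖flipWeight D β t‖))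
  rw [mul_zero, mul_zero] at hbd
  have hdiff := squeeze_zero_norm' (t₀ := atTop) (f := fun n : ℕ =>
    (∫ J : Hyperedge D n → ℝ, energy J β γ ∂(Measure.pi fun _ => μ n)) / (n : ℂ)
        - ((n.choose D : ℝ) / (n : ℝ) ^ D : ℝ) * limitEnergy D β a lam) (by
      filter_upwards [hl, eventually_gt_atTop 0] with n hn1 hn2
      exact norm_integral_energy_sub_le hD hn2 (hμ n) β hn1 a hlam) hbd
  simpa using hdiff.add hmain

/-- The limit energy is a difference of two `D`-th powers. -/
theorem limitEnergy_eq (D : ℕ) (β : ℝ) (a : ℂ) (lam : ℝ) :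
    limitEnergy D β a lam = -(Complex.I * a.im / 2) *
      ((Real.cos β + Complex.I * Real.sin β * Real.exp lam) ^ D
        - (Real.cos β - Complex.I * Real.sin β * Real.exp lam) ^ D) := by
  -- `add_pow` puts the summation index on the first summand, so the sine term is moved to the front
  -- to carry the exponent `t`. Even powers then cancel in the difference and odd ones double.
  rw [sub_eq_add_neg (Real.cos β : ℂ), add_comm (Real.cos β : ℂ), add_comm (Real.cos β : ℂ),
    add_pow, add_pow, ← Finset.sum_sub_distrib, Finset.mul_sum, limitEnergy]
  refine Finset.sum_congr rfl fun t _ => ?_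
  have he : (Real.exp (t * lam) : ℂ) = (Real.exp lam : ℂ) ^ t := by
    rw [Real.exp_nat_mul, Complex.ofReal_pow]
  have hm : (-Complex.I * (Real.sin β : ℂ)) ^ t * (Real.exp lam : ℂ) ^ t
      = (-(Complex.I * Real.sin β * Real.exp lam)) ^ t := by
    rw [← mul_pow]; congr 1; ring
  rw [flipWeight, limitFlip, nsmul_eq_mul]
  split_ifs with ho
  · rw [he, ho.neg_pow, ← mul_assoc, mul_comm _ ((Real.exp lam : ℂ) ^ t)]
    rw [ho.neg_pow] at hm
    linear_combination (D.choose t : ℂ) * (Real.cos β : ℂ) ^ (D - t) * (Complex.I * a.im) * hm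
  · rw [(Nat.not_odd_iff_even.1 ho).neg_pow]
    ring

/-! ### Dense couplings. -/

/-- Differentiation under the integral sign, dominated by `|x|`. It gives the Gaussian moment
transform without computing an integral. -/
theorem hasDerivAt_charFun {μ : Measure ℝ} [IsProbabilityMeasure μ]
    (hμ : Integrable (fun x : ℝ => x) μ) (t : ℝ) :
    HasDerivAt (charFun μ) (Complex.I * momentFun μ t) t := by
  have h := (hasDerivAt_integral_of_dominated_loc_of_deriv_le (μ := μ) (x₀ := t)
    (F := fun (s x : ℝ) => Complex.exp (s * x * Complex.I))
    (F' := fun (s x : ℝ) => Complex.I * ((x : ℂ) * Complex.exp (s * x * Complex.I)))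
    (bound := fun x => ‖x‖) (s := Set.univ) univ_mem (Eventually.of_forall fun s => by fun_prop)
    (integrable_exp_mul_mul_I μ t) (by fun_prop) (ae_of_all _ fun x s _ => ?_) hμ.norm
    (ae_of_all _ fun x s _ => ?_)).2
  · rw [integral_const_mul] at h
    have e : charFun μ = fun s : ℝ => ∫ x, Complex.exp (s * x * Complex.I) ∂μ := by
      funext s; exact charFun_apply_real s
    rw [e]
    exact h
  · rw [norm_mul, norm_mul, norm_exp_mul_mul_I, Complex.norm_I, Complex.norm_real, one_mul, mul_one]
  · have h1 : HasDerivAt (fun s : ℝ => (s : ℂ) * x * Complex.I) (1 * x * Complex.I) s :=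
      ((Complex.ofRealCLM.hasDerivAt (x := s)).mul_const (x : ℂ)).mul_const Complex.I
    have h2 := h1.cexp
    convert! h2 using 1
    ring

theorem integrable_gaussianReal (m : ℝ) (v : NNReal) :
    Integrable (fun x : ℝ => x) (gaussianReal m v) :=
  memLp_one_iff_integrable.1 (memLp_id_gaussianReal 1)

theorem charFun_centered_gaussianReal (v : NNReal) (t : ℝ) :
    charFun (gaussianReal 0 v) t = Complex.exp (-(v * t ^ 2 / 2) : ℝ) := by
  rw [charFun_gaussianReal]
  congr 1
  push_cast
  ring

theorem momentFun_gaussianReal (v : NNReal) (t : ℝ) :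
    momentFun (gaussianReal 0 v) t = Complex.I * (v * t * Real.exp (-(v * t ^ 2 / 2)) : ℝ) := by
  have h1 := hasDerivAt_charFun (integrable_gaussianReal 0 v) t
  have h2 : HasDerivAt (fun t : ℝ => ((Real.exp (-(v * t ^ 2 / 2)) : ℝ) : ℂ))
      ((Real.exp (-(v * t ^ 2 / 2)) * (-(v * (2 * t) / 2)) : ℝ) : ℂ) t := by
    refine HasDerivAt.ofReal_comp ?_
    refine HasDerivAt.exp (((HasDerivAt.const_mul _ ?_).div_const 2).neg)
    simpa using hasDerivAt_pow 2 t
  have e : charFun (gaussianReal 0 v)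
      = fun t : ℝ => ((Real.exp (-(v * t ^ 2 / 2)) : ℝ) : ℂ) := by
    funext t
    rw [charFun_centered_gaussianReal, Complex.ofReal_exp]
  rw [e] at h1
  have h3 := h1.unique h2
  have h4 : momentFun (gaussianReal 0 v) t
      = -Complex.I * (Complex.I * momentFun (gaussianReal 0 v) t) := by
    rw [← mul_assoc, neg_mul, Complex.I_mul_I]; ring
  rw [h4, h3]
  push_cast
  ring

/-- The variance `n^{1 - D}` of the dense couplings. -/
def denseVariance (D n : ℕ) : NNReal :=
  .mk (((n : ℝ) ^ ((1 - (D : ℝ)) / 2)) ^ 2) (sq_nonneg _)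

theorem denseLaw_eq (D n : ℕ) :
    denseLaw D n = Measure.pi fun _ => gaussianReal 0 (denseVariance D n) := by
  rw [denseLaw]
  congr 1
  funext S
  rw [gaussianReal_map_const_mul, mul_zero, mul_one]
  rfl

theorem pow_mul_denseVariance {D n : ℕ} (hD : 1 ≤ D) (hn : 0 < n) :
    (n : ℝ) ^ (D - 1) * denseVariance D n = 1 := by
  have hn' : (0 : ℝ) < n := by exact_mod_cast hn
  have h : ((denseVariance D n : NNReal) : ℝ) = ((n : ℝ) ^ ((1 - (D : ℝ)) / 2)) ^ 2 := rfl
  rw [h, ← Real.rpow_natCast, ← Real.rpow_natCast, ← Real.rpow_mul hn'.le, ← Real.rpow_add hn']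
  rw [Nat.cast_sub hD]
  push_cast
  rw [show (D : ℝ) - 1 + (1 - D) / 2 * 2 = 0 by ring, Real.rpow_zero]

theorem tendsto_denseVariance {D : ℕ} (hD : 2 ≤ D) :
    Tendsto (fun n : ℕ => (denseVariance D n : ℝ)) atTop (𝓝 0) := by
  have h : Tendsto (fun n : ℕ => ((n : ℝ) ^ (D - 1))⁻¹) atTop (𝓝 0) :=
    ((tendsto_pow_atTop (by omega)).comp tendsto_natCast_atTop_atTop).inv_tendsto_atTop
  refine h.congr' ?_
  filter_upwards [eventually_gt_atTop 0] with n hn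
  rw [inv_eq_of_mul_eq_one_right (pow_mul_denseVariance (by omega) hn)]

theorem tendsto_dense {D : ℕ} (hD : 2 ≤ D) (β γ : ℝ) :
    Tendsto (fun n : ℕ => (∫ J, energy J β γ ∂(denseLaw D n)) / ((n : ℂ) / (D ! : ℂ)))
      atTop (𝓝 (closedForm D β γ)) := by
  have hf : ((D - 1)! : ℝ) ≠ 0 := by positivity
  have hev : ∀ᶠ n : ℕ in atTop, (n : ℝ) ^ (D - 1) * denseVariance D n = 1 := by
    filter_upwards [eventually_gt_atTop 0] with n hn
    exact pow_mul_denseVariance (by omega) hn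
  -- Since `n^(D-1)` times the variance is 1, `n^(D-1) l = -γ²/2`, which is `(D-1)!` times the
  -- chosen `lam`, and the rescaled moment at `γ` tends to `iγ`. The law is centred, whence `m = 0`.
  have key := tendsto_integral_energy hD β γ (fun n => gaussianReal 0 (denseVariance D n))
    (fun n => integrable_gaussianReal _ _) (fun n => (-(denseVariance D n * γ ^ 2 / 2) : ℝ))
    (Eventually.of_forall fun n => charFun_centered_gaussianReal _ _)
    (lam := -(γ ^ 2) / (2 * (D - 1)!))
    (div_nonpos_of_nonpos_of_nonneg (neg_nonpos.2 (sq_nonneg _)) (by positivity))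
    (a := Complex.I * γ) (m := 0) ?_ ?_ ?_ ?_
  · have h := key.const_mul (D ! : ℂ)
    have hD0 : (D ! : ℂ) ≠ 0 := by exact_mod_cast D.factorial_ne_zero
    have e : (D ! : ℂ) * ((1 / D ! : ℝ) * limitEnergy D β (Complex.I * γ)
        (-(γ ^ 2) / (2 * (D - 1)!))) = closedForm D β γ := by
      rw [limitEnergy_eq, closedForm]
      have : (Complex.I * (γ : ℂ)).im = γ := by simp
      rw [this, ← mul_assoc]
      push_cast
      rw [mul_one_div_cancel hD0, one_mul]
    rw [e] at h
    refine h.congr fun n => ?_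
    rw [denseLaw_eq]
    field_simp
  · refine tendsto_const_nhds.congr' ?_
    filter_upwards [hev] with n hn
    rw [Complex.ofReal_re]
    field_simp
    linear_combination γ ^ 2 * hn
  · simp only [Complex.ofReal_im]
    simp
  · have h : Tendsto (fun n : ℕ => Complex.I * ((γ * Real.exp (-(denseVariance D n * γ ^ 2 / 2)) : ℝ)
        : ℂ)) atTop (𝓝 (Complex.I * ((γ * Real.exp (-(0 * γ ^ 2 / 2)) : ℝ) : ℂ))) :=
      ((Complex.continuous_ofReal.tendsto _).comp (((Real.continuous_exp.tendsto _).comp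
        (((tendsto_denseVariance hD).mul_const _).div_const 2).neg).const_mul γ)).const_mul _
    simp only [zero_mul, zero_div, neg_zero, Real.exp_zero, mul_one] at h
    refine h.congr' ?_
    filter_upwards [hev] with n hn
    have hn' : (n : ℂ) ^ (D - 1) * ((denseVariance D n : ℝ) : ℂ) = 1 := by exact_mod_cast hn
    rw [momentFun_gaussianReal]
    push_cast
    linear_combination -(Complex.I * γ * Complex.exp (-(denseVariance D n * γ ^ 2 / 2))) * hn'
  · simp [momentFun_gaussianReal]

/-! ### Diluted couplings. -/

theorem tendsto_dilutedProb {D : ℕ} (hD : 2 ≤ D) {d : ℝ} (hd : 0 ≤ d) :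
    Tendsto (fun n : ℕ => (n : ℝ) ^ (D - 1) * (dilutedProb D n d : ℝ)) atTop
      (𝓝 (d * (D - 1)!)) := by
  have hD' : (D : ℝ) ≠ 0 := by positivity
  have h1 : Tendsto (fun n : ℕ => (n : ℝ) ^ (D - 1) * ((n : ℝ) * d / ((D : ℝ) * (n.choose D : ℝ))))
      atTop (𝓝 (d * (D - 1)!)) := by
    have h := ((tendsto_choose_div_pow D).inv₀ (by positivity)).const_mul (d / D)
    have e : d / D * (1 / (D ! : ℝ))⁻¹ = d * (D - 1)! := by
      rw [← Nat.mul_factorial_pred (show D ≠ 0 by omega)]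
      push_cast; field_simp
    rw [e] at h
    refine h.congr fun n => ?_
    have hp : (n : ℝ) ^ D = n ^ (D - 1) * n := by rw [← pow_succ]; congr 1; omega
    rw [inv_div, hp]
    ring
  have h2 : Tendsto (fun n : ℕ => (n : ℝ) * d / ((D : ℝ) * (n.choose D : ℝ))) atTop (𝓝 0) := by
    have h := h1.div_atTop ((tendsto_pow_atTop (α := ℝ) (show D - 1 ≠ 0 by omega)).comp
      tendsto_natCast_atTop_atTop)
    refine h.congr' ?_
    filter_upwards [eventually_gt_atTop 0] with n hn
    have : (n : ℝ) ^ (D - 1) ≠ 0 := by positivity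
    simp only [Function.comp_apply]
    rw [mul_div_cancel_left₀ _ this]
  refine h1.congr' ?_
  -- The untruncated probability tends to 0, so the truncation is eventually inactive.
  filter_upwards [h2.eventually_le_const zero_lt_one] with n hn
  rw [dilutedProb, Set.coe_projIcc, min_eq_right hn, max_eq_right (by positivity)]

theorem charFun_bernoulliMeasure (p : unitInterval) (t : ℝ) :
    charFun (bernoulliMeasure (1 : ℝ) 0 p) t = 1 + p * (Complex.exp (t * Complex.I) - 1) := by
  rw [charFun_apply_real, integral_bernoulliMeasure]
  simp
  ring

theorem momentFun_bernoulliMeasure (p : unitInterval) (t : ℝ) :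
    momentFun (bernoulliMeasure (1 : ℝ) 0 p) t = p * Complex.exp (t * Complex.I) := by
  rw [momentFun, integral_bernoulliMeasure]
  simp

/-- The infinite-size diluted energy at average degree `d`. -/
def dilutedLimit (D : ℕ) (β γ d : ℝ) : ℂ :=
  -(Complex.I * Real.sin γ / 2) *
    ((Real.cos β + Complex.I * Real.sin β * Real.exp (d * (Real.cos γ - 1))) ^ D
      - (Real.cos β - Complex.I * Real.sin β * Real.exp (d * (Real.cos γ - 1))) ^ D)

/-- Here `log(1 + z) - z = O(|z|²)`, and `n^k |z|² → 0` because `n^k z` stays bounded while `z → 0`.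
-/
theorem tendsto_pow_mul_log {k : ℕ} (hk : k ≠ 0) {z : ℕ → ℂ} {w : ℂ}
    (hz : Tendsto (fun n : ℕ => (n : ℂ) ^ k * z n) atTop (𝓝 w)) :
    Tendsto (fun n : ℕ => (n : ℂ) ^ k * Complex.log (1 + z n)) atTop (𝓝 w) ∧
      Tendsto z atTop (𝓝 0) := by
  have hz0 : Tendsto z atTop (𝓝 0) := by
    rw [tendsto_zero_iff_norm_tendsto_zero]
    have h := hz.norm.div_atTop ((tendsto_pow_atTop (α := ℝ) hk).comp tendsto_natCast_atTop_atTop)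
    refine h.congr' ?_
    filter_upwards [eventually_gt_atTop 0] with n hn
    have : (n : ℝ) ^ k ≠ 0 := by positivity
    simp only [Function.comp_apply, norm_mul, norm_pow, Complex.norm_natCast]
    rw [mul_div_cancel_left₀ _ this]
  refine ⟨?_, hz0⟩
  have hb : Tendsto (fun n : ℕ => ‖(n : ℂ) ^ k * z n‖ * ‖z n‖) atTop (𝓝 0) := by
    simpa using hz.norm.mul hz0.norm
  have hd := squeeze_zero_norm' (t₀ := atTop)
    (f := fun n : ℕ => (n : ℂ) ^ k * Complex.log (1 + z n) - (n : ℂ) ^ k * z n) (by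
      filter_upwards [hz0.norm.eventually_le_const (show ‖(0 : ℂ)‖ < 1 / 2 by simp)] with n hn
      rw [← mul_sub, norm_mul, norm_mul, mul_assoc]
      refine mul_le_mul_of_nonneg_left ?_ (norm_nonneg _)
      refine (Complex.norm_log_one_add_sub_self_le (by linarith)).trans ?_
      have h1 : (1 - ‖z n‖)⁻¹ ≤ 2 := by
        rw [inv_le_comm₀ (by linarith) two_pos]; linarith
      nlinarith [sq_nonneg ‖z n‖]) hb
  simpa using hd.add hz

theorem tendsto_diluted {D : ℕ} (hD : 2 ≤ D) (β γ : ℝ) {d : ℝ} (hd : 0 < d) :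
    Tendsto (fun n : ℕ => (∫ J, energy J β γ ∂(dilutedLaw D n d))
        / ((n : ℂ) * (d : ℂ) / (D : ℂ))) atTop (𝓝 (dilutedLimit D β γ d)) := by
  have hk : D - 1 ≠ 0 := by omega
  have hp : Tendsto (fun n : ℕ => (n : ℂ) ^ (D - 1) * ((dilutedProb D n d : ℝ) : ℂ)) atTop
      (𝓝 ((d * (D - 1)! : ℝ) : ℂ)) := by
    refine ((Complex.continuous_ofReal.tendsto _).comp (tendsto_dilutedProb hD hd.le)).congr
      fun n => ?_
    simp
  set z : ℕ → ℂ := fun n => (dilutedProb D n d : ℝ) * (Complex.exp (γ * Complex.I) - 1) with hz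
  have hz1 : Tendsto (fun n : ℕ => (n : ℂ) ^ (D - 1) * z n) atTop
      (𝓝 ((d * (D - 1)! : ℝ) * (Complex.exp (γ * Complex.I) - 1))) :=
    (hp.mul_const _).congr fun n => by rw [hz]; ring
  obtain ⟨hlog, hz0⟩ := tendsto_pow_mul_log hk hz1
  -- The logarithm behaves like `p (e^{iγ} - 1)` and `n^(D-1) p → d (D-1)!`: the real part gives
  -- `lam`. The moment transform `p e^{iγ}` gives `a`, and its value at `0` gives `m`.
  have key := tendsto_integral_energy hD β γ (fun n => bernoulliMeasure (1 : ℝ) 0 (dilutedProb D n d))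
    (fun n => integrable_bernoulliMeasure _ _ _ _) (fun n => Complex.log (1 + z n)) ?_
    (lam := d * (Real.cos γ - 1))
    (mul_nonpos_of_nonneg_of_nonpos hd.le (by linarith [Real.cos_le_one γ]))
    (a := (d * (D - 1)! : ℝ) * Complex.exp (γ * Complex.I)) (m := (d * (D - 1)! : ℝ)) ?_ ?_ ?_ ?_
  · have h := key.const_mul (D / d : ℂ)
    have hd0 : (d : ℂ) ≠ 0 := by exact_mod_cast hd.ne'
    have hf : ((D - 1)! : ℂ) ≠ 0 := by exact_mod_cast (D - 1).factorial_ne_zero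
    have hD0 : (D : ℂ) ≠ 0 := by exact_mod_cast (show D ≠ 0 by omega)
    have e : (D / d : ℂ) * ((1 / D ! : ℝ) * limitEnergy D β
        ((d * (D - 1)! : ℝ) * Complex.exp (γ * Complex.I)) (d * (Real.cos γ - 1)))
        = dilutedLimit D β γ d := by
      rw [limitEnergy_eq, dilutedLimit, Complex.im_ofReal_mul, Complex.exp_ofReal_mul_I_im,
        ← Nat.mul_factorial_pred (show D ≠ 0 by omega), ← mul_assoc, ← mul_assoc]
      congr 1
      push_cast
      field_simp
    rw [e] at h
    refine h.congr fun n => ?_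
    rw [dilutedLaw]
    field_simp
  · filter_upwards [hz0.norm.eventually_lt_const (show ‖(0 : ℂ)‖ < 1 by simp)] with n hn
    rw [Complex.exp_log, charFun_bernoulliMeasure]
    intro h0
    rw [eq_neg_of_add_eq_zero_right h0] at hn
    simp at hn
  · have h := (Complex.continuous_re.tendsto _).comp hlog
    rw [Complex.re_ofReal_mul, Complex.sub_re, Complex.exp_ofReal_mul_I_re, Complex.one_re] at h
    rw [← mul_assoc, mul_comm ((D - 1)! : ℝ)]
    refine h.congr fun n => ?_
    simp only [Function.comp_apply]
    rw [← Complex.ofReal_natCast, ← Complex.ofReal_pow, Complex.re_ofReal_mul]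
  · have h := (Complex.continuous_im.tendsto _).comp hlog
    -- The rescaled imaginary part converges, so its square divided by `n^(D-1)`, which is the
    -- required quantity, tends to 0.
    have h2 := (h.pow 2).div_atTop
      ((tendsto_pow_atTop (α := ℝ) hk).comp tendsto_natCast_atTop_atTop)
    refine h2.congr' ?_
    filter_upwards [eventually_gt_atTop 0] with n hn
    have : (n : ℝ) ≠ 0 := by positivity
    simp only [Function.comp_apply]
    rw [← Complex.ofReal_natCast, ← Complex.ofReal_pow, Complex.im_ofReal_mul]
    field_simp
  · refine (hp.mul_const _).congr fun n => ?_
    rw [momentFun_bernoulliMeasure, mul_assoc]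
  · refine hp.congr fun n => ?_
    rw [momentFun_bernoulliMeasure]
    simp

/-! ### Comparison of the two limits at large degree. -/

theorem norm_pow_sub_pow_le {a b : ℂ} {R : ℝ} (hR : 1 ≤ R) (ha : ‖a‖ ≤ R) (hb : ‖b‖ ≤ R) (n : ℕ) :
    ‖a ^ n - b ^ n‖ ≤ n * R ^ n * ‖a - b‖ := by
  induction n with
  | zero => simp
  | succ n ih =>
    have e : a ^ (n + 1) - b ^ (n + 1) = a ^ n * (a - b) + (a ^ n - b ^ n) * b := by ring
    have hR0 : 0 ≤ R := by linarith
    rw [e]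
    calc _ ≤ ‖a ^ n * (a - b)‖ + ‖(a ^ n - b ^ n) * b‖ := norm_add_le _ _
      _ ≤ R ^ (n + 1) * ‖a - b‖ + (n * R ^ n * ‖a - b‖) * R := by
        rw [norm_mul, norm_mul, norm_pow]
        gcongr
        exact (pow_le_pow_left₀ (norm_nonneg _) ha n).trans (pow_le_pow_right₀ hR n.le_succ)
      _ = _ := by push_cast; ring

/-- A quadratic bound is enough, since `x²` will be of order `1/d`. Taylor's bound serves for `|x| ≤
1` and `|sin x - x| ≤ 1 + |x|` otherwise. -/
theorem abs_sin_sub_self_le (x : ℝ) : |Real.sin x - x| ≤ 2 * x ^ 2 := by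
  rw [← sq_abs]
  rcases le_total |x| 1 with h | h
  · have h1 := Real.sin_bound h
    have h2 : |x ^ 3 / 6| = |x| ^ 3 / 6 := by rw [abs_div, abs_pow]; norm_num
    have h3 : |Real.sin x - x| ≤ |Real.sin x - (x - x ^ 3 / 6)| + |x ^ 3 / 6| := by
      have e : Real.sin x - x = (Real.sin x - (x - x ^ 3 / 6)) + -(x ^ 3 / 6) := by ring
      rw [e, ← abs_neg (x ^ 3 / 6)]
      exact abs_add_le _ _
    have h4 : |x| ^ 3 ≤ |x| ^ 2 := pow_le_pow_of_le_one (abs_nonneg _) h (by norm_num)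
    have h5 : |x| ^ 5 ≤ |x| ^ 2 := pow_le_pow_of_le_one (abs_nonneg _) h (by norm_num)
    have h6 := sq_nonneg |x|
    rw [h2] at h3
    linarith
  · have h1 : |Real.sin x - x| ≤ |Real.sin x| + |x| := abs_sub _ _
    have h2 := Real.abs_sin_le_one x
    nlinarith

theorem abs_cos_sub_one_add_le (x : ℝ) : |Real.cos x - 1 + x ^ 2 / 2| ≤ x ^ 4 := by
  have hx4 : x ^ 4 = |x| ^ 4 := by rw [← abs_pow]; exact (abs_of_nonneg (by positivity)).symm
  rcases le_total |x| 1 with h | h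
  · have h1 := Real.cos_bound h
    rw [show Real.cos x - 1 + x ^ 2 / 2 = Real.cos x - (1 - x ^ 2 / 2) by ring, hx4]
    have h2 : 0 ≤ |x| ^ 4 := by positivity
    linarith
  · have h1 := Real.one_sub_sq_div_two_le_cos (x := x)
    have h2 := Real.cos_le_one x
    have h3 : 1 ≤ x ^ 2 := by rw [← sq_abs]; exact one_le_pow₀ h
    rw [abs_of_nonneg (by linarith)]
    nlinarith

/-- The difference of powers in the closed form, as a function of the damping factor. -/
def powDiff (D : ℕ) (β e : ℝ) : ℂ :=
  (Real.cos β + Complex.I * Real.sin β * e) ^ D - (Real.cos β - Complex.I * Real.sin β * e) ^ D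

theorem norm_I_mul_sin_mul_le (β e : ℝ) : ‖Complex.I * Real.sin β * (e : ℂ)‖ ≤ |e| := by
  rw [norm_mul, norm_mul, Complex.norm_I, one_mul, Complex.norm_real, Complex.norm_real,
    Real.norm_eq_abs, Real.norm_eq_abs]
  exact mul_le_of_le_one_left (abs_nonneg _) (Real.abs_sin_le_one β)

theorem norm_cos_le_one (β : ℝ) : ‖(Real.cos β : ℂ)‖ ≤ 1 := by
  rw [Complex.norm_real]; exact Real.abs_cos_le_one β

theorem norm_cos_add_le {β e : ℝ} (he : |e| ≤ 1) :
    ‖(Real.cos β : ℂ) + Complex.I * Real.sin β * e‖ ≤ 2 := by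
  linarith [norm_add_le (Real.cos β : ℂ) (Complex.I * Real.sin β * e), norm_cos_le_one β,
    norm_I_mul_sin_mul_le β e]

theorem norm_cos_sub_le {β e : ℝ} (he : |e| ≤ 1) :
    ‖(Real.cos β : ℂ) - Complex.I * Real.sin β * e‖ ≤ 2 := by
  linarith [norm_sub_le (Real.cos β : ℂ) (Complex.I * Real.sin β * e), norm_cos_le_one β,
    norm_I_mul_sin_mul_le β e]

theorem norm_powDiff_le (D : ℕ) (β : ℝ) {e : ℝ} (he : |e| ≤ 1) :
    ‖powDiff D β e‖ ≤ 2 * 2 ^ D := by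
  refine (norm_sub_le _ _).trans ?_
  rw [norm_pow, norm_pow]
  linarith [pow_le_pow_left₀ (norm_nonneg _) (norm_cos_add_le (β := β) he) D,
    pow_le_pow_left₀ (norm_nonneg _) (norm_cos_sub_le (β := β) he) D]

theorem norm_powDiff_sub_le (D : ℕ) (β : ℝ) {e e' : ℝ} (he : |e| ≤ 1) (he' : |e'| ≤ 1) :
    ‖powDiff D β e - powDiff D β e'‖ ≤ 2 * (D * 2 ^ D * |e - e'|) := by
  have h1 := norm_pow_sub_pow_le one_le_two (norm_cos_add_le (β := β) he)
    (norm_cos_add_le (β := β) he') D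
  have h2 := norm_pow_sub_pow_le one_le_two (norm_cos_sub_le (β := β) he)
    (norm_cos_sub_le (β := β) he') D
  have h3 := norm_I_mul_sin_mul_le β (e - e')
  have e1 : ((Real.cos β : ℂ) + Complex.I * Real.sin β * e)
      - (Real.cos β + Complex.I * Real.sin β * e')
      = Complex.I * Real.sin β * ((e - e' : ℝ) : ℂ) := by push_cast; ring
  have e2 : ((Real.cos β : ℂ) - Complex.I * Real.sin β * e)
      - (Real.cos β - Complex.I * Real.sin β * e')
      = -(Complex.I * Real.sin β * ((e - e' : ℝ) : ℂ)) := by push_cast; ring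
  rw [e1] at h1
  rw [e2, norm_neg] at h2
  have h4 : (D * 2 ^ D * ‖Complex.I * Real.sin β * ((e - e' : ℝ) : ℂ)‖ : ℝ)
      ≤ D * 2 ^ D * |e - e'| := by gcongr
  have e3 : powDiff D β e - powDiff D β e'
      = (((Real.cos β : ℂ) + Complex.I * Real.sin β * e) ^ D
          - (Real.cos β + Complex.I * Real.sin β * e') ^ D)
        - (((Real.cos β : ℂ) - Complex.I * Real.sin β * e) ^ D
          - (Real.cos β - Complex.I * Real.sin β * e') ^ D) := by
    rw [powDiff, powDiff]; ring
  rw [e3]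
  linarith [norm_sub_le (((Real.cos β : ℂ) + Complex.I * Real.sin β * e) ^ D
          - (Real.cos β + Complex.I * Real.sin β * e') ^ D)
        (((Real.cos β : ℂ) - Complex.I * Real.sin β * e) ^ D
          - (Real.cos β - Complex.I * Real.sin β * e') ^ D)]

/-- The diluted limit at angle `γ / √((D - 1)! d)` is the rescaled closed form up to `O(1/d)`. -/
theorem norm_dilutedLimit_sub_le (D : ℕ) (β : ℝ) {γ Γ d : ℝ} (hγ : |γ| ≤ Γ) (hd : 0 < d) :
    ‖dilutedLimit D β (γ / Real.sqrt ((D - 1)! * d)) d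
        - ((1 / Real.sqrt ((D - 1)! * d) : ℝ) : ℂ) * closedForm D β γ‖
      ≤ (2 * 2 ^ D * Γ ^ 2 + D * 2 ^ D * Γ ^ 4) / d := by
  have hf1 : (1 : ℝ) ≤ (D - 1)! := by exact_mod_cast Nat.one_le_iff_ne_zero.2 (D - 1).factorial_ne_zero
  have hf : (0 : ℝ) < (D - 1)! := by linarith
  set r := Real.sqrt ((D - 1)! * d) with hr
  have hr2 : r ^ 2 = (D - 1)! * d := Real.sq_sqrt (by positivity)
  have hr0 : r ≠ 0 := (Real.sqrt_pos.2 (by positivity)).ne'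
  set x := γ / r with hx
  have hx2 : x ^ 2 = γ ^ 2 / ((D - 1)! * d) := by rw [hx, div_pow, hr2]
  have hγ2 : γ ^ 2 ≤ Γ ^ 2 := by
    rw [← sq_abs]; exact pow_le_pow_left₀ (abs_nonneg _) hγ 2
  have hxd : x ^ 2 ≤ Γ ^ 2 / d := by
    rw [hx2]
    -- The factor `(D-1)! ≥ 1` in the denominator is dropped.
    gcongr
    nlinarith
  have hx4 : d * x ^ 4 ≤ Γ ^ 4 / d := by
    have h := pow_le_pow_left₀ (sq_nonneg x) hxd 2
    calc d * x ^ 4 = d * (x ^ 2) ^ 2 := by ring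
      _ ≤ d * (Γ ^ 2 / d) ^ 2 := by gcongr
      _ = Γ ^ 4 / d := by field_simp
  set u := d * (Real.cos x - 1) with hu
  set w := -(γ ^ 2) / (2 * (D - 1)!) with hw
  have hwx : w = -(d * x ^ 2 / 2) := by rw [hw, hx2]; field_simp
  have hu0 : u ≤ 0 := mul_nonpos_of_nonneg_of_nonpos hd.le (by linarith [Real.cos_le_one x])
  have hw0 : w ≤ 0 := by rw [hwx]; have : 0 ≤ d * x ^ 2 := by positivity
                         linarith
  have hexp : ∀ {s : ℝ}, s ≤ 0 → |Real.exp s| ≤ 1 := fun h => by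
    rw [abs_of_pos (Real.exp_pos _)]; exact Real.exp_le_one_iff.2 h
  have huw : |Real.exp u - Real.exp w| ≤ Γ ^ 4 / d := by
    refine (abs_exp_sub_exp_le hu0 hw0).trans (le_trans ?_ hx4)
    rw [hu, hwx, show d * (Real.cos x - 1) - -(d * x ^ 2 / 2)
      = d * (Real.cos x - 1 + x ^ 2 / 2) by ring, abs_mul, abs_of_pos hd]
    gcongr
    exact abs_cos_sub_one_add_le x
  -- Two replacements are separated: the prefactor `sin x` by `x = γ / r`, and the damping `exp u`
  -- by `exp w`. Each costs `O(1/d)`, uniformly in `β`.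
  have e : dilutedLimit D β x d - ((1 / r : ℝ) : ℂ) * closedForm D β γ
      = -(Complex.I / 2) * (((Real.sin x - x : ℝ) : ℂ) * powDiff D β (Real.exp w)
        + (Real.sin x : ℂ) * (powDiff D β (Real.exp u) - powDiff D β (Real.exp w))) := by
    have h1 : dilutedLimit D β x d = -(Complex.I * Real.sin x / 2) * powDiff D β (Real.exp u) := rfl
    have h2 : closedForm D β γ = -(Complex.I * γ / 2) * powDiff D β (Real.exp w) := rfl
    rw [h1, h2, hx]
    push_cast
    ring
  rw [e, norm_mul, norm_neg, norm_div, Complex.norm_I, Complex.norm_two]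
  have h1 : ‖((Real.sin x - x : ℝ) : ℂ) * powDiff D β (Real.exp w)‖
      ≤ 2 * (Γ ^ 2 / d) * (2 * 2 ^ D) := by
    rw [norm_mul, Complex.norm_real]
    exact mul_le_mul ((abs_sin_sub_self_le x).trans (by linarith))
      (norm_powDiff_le D β (hexp hw0)) (norm_nonneg _) (by positivity)
  have h2 : ‖(Real.sin x : ℂ) * (powDiff D β (Real.exp u) - powDiff D β (Real.exp w))‖
      ≤ 1 * (2 * (D * 2 ^ D * (Γ ^ 4 / d))) := by
    rw [norm_mul, Complex.norm_real]
    refine mul_le_mul (Real.abs_sin_le_one x) ((norm_powDiff_sub_le D β (hexp hu0) (hexp hw0)).trans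
      ?_) (norm_nonneg _) zero_le_one
    gcongr
  have h3 := norm_add_le (((Real.sin x - x : ℝ) : ℂ) * powDiff D β (Real.exp w))
    ((Real.sin x : ℂ) * (powDiff D β (Real.exp u) - powDiff D β (Real.exp w)))
  have h4 : (2 * 2 ^ D * Γ ^ 2 + D * 2 ^ D * Γ ^ 4) / d
      = 1 / 2 * (2 * (Γ ^ 2 / d) * (2 * 2 ^ D) + 1 * (2 * (D * 2 ^ D * (Γ ^ 4 / d)))) := by
    ring
  rw [h4]
  gcongr
  linarith

end

end QAOA

theorem mainTheorem4 (D : ℕ) (hD : 3 ≤ D) :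
    -- the expectations exist
    (∀ (n : ℕ) (β γ : ℝ),
      Integrable (fun J => QAOA.energy J β γ) (QAOA.denseLaw D n) ∧
      ∀ d : ℝ, Integrable (fun J => QAOA.energy J β γ) (QAOA.dilutedLaw D n d)) ∧
    -- the constant of the error term depends on `D` and on a bound for `|γ|` only
    ∀ Γ : ℝ, ∃ C : ℝ, ∀ β γ : ℝ, |γ| ≤ Γ →
      ∃ M : ℂ,
        -- the infinite-size dense energy, per `n / D!`, exists and is the closed form
        Tendsto (fun n : ℕ =>
            (∫ J, QAOA.energy J β γ ∂(QAOA.denseLaw D n)) / ((n : ℂ) / (D ! : ℂ)))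
          atTop (𝓝 M) ∧
        M = QAOA.closedForm D β γ ∧
        ∀ d : ℝ, 3 ≤ d →
          ∃ L : ℂ,
            -- the infinite-size diluted energy, per `n d / D`, exists
            Tendsto (fun n : ℕ =>
                (∫ J, QAOA.energy J β (γ / Real.sqrt ((D - 1)! * d)) ∂(QAOA.dilutedLaw D n d))
                  / ((n : ℂ) * (d : ℂ) / (D : ℂ)))
              atTop (𝓝 L) ∧
            ‖L - ((1 / Real.sqrt ((D - 1)! * d) : ℝ) : ℂ) * QAOA.closedForm D β γ‖ ≤ C / d ∧
            ‖L - ((1 / Real.sqrt ((D - 1)! * d) : ℝ) : ℂ) * M‖ ≤ C / d := by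
  refine ⟨fun n β γ => ⟨?_, fun d => QAOA.integrable_energy β γ
    (integrable_bernoulliMeasure _ _ _ _)⟩, fun Γ => ⟨2 * 2 ^ D * Γ ^ 2 + D * 2 ^ D * Γ ^ 4,
    fun β γ hγ => ⟨QAOA.closedForm D β γ, QAOA.tendsto_dense (by omega) β γ, rfl, fun d hd => ?_⟩⟩⟩
  · rw [QAOA.denseLaw_eq]
    exact QAOA.integrable_energy β γ (QAOA.integrable_gaussianReal _ _)
  · have hd0 : 0 < d := by linarith
    have h := QAOA.norm_dilutedLimit_sub_le D β hγ hd0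
    exact ⟨_, QAOA.tendsto_diluted (by omega) β _ hd0, h, h⟩
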